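/- For integers $k\ge 0$ and $n>0$ let $$n=\binom{n_{k+1}}{k+1}+\binom{n_k}{k}+\dots+\binom{n_i}{i},\qquad n_{k+1}>n_k>\dots>n_i\ge i\ge 1,$$ be the unique expansion of this form, and put $$\partial^{k}(n)=\binom{n_{k+1}-1}{k}+\binom{n_k-1}{k-1}+\dots+\binom{n_i-1}{i-1},\qquad \partial^k(0)=0.$$ For a ranked poset $P$ with finitely many elements of each rank, let $f_{j}$ be the number of elements of rank $j+1$ $(j\ge -1)$. We say that $P$ satisfies the *Macaulay inequalities* if $0\le\partial^k(f_k)\le f_{k-1}$ for all $k\ge 0$. Let $L$ be a meet semi-lattice with minimum, ranked by $r:L\to\mathbb N$ with $r(\hat 0)=0$, with finitely many elements of each rank. Let $L_1$ be its set of atoms. $L$ is *geometric* if every element of $L$ is a join of atoms and $r(x\wedge y)+r(x\vee y)\le r(x)+r(y)$ for all $x,y\in L$ such that $x\vee y$ exists. Let $\mathfrak P$ be the family of ranked posets of monomials constructed as follows. Start with a geometric meet semi-lattice $L$. Let $M_0$ be the set of all monomials $m(l)=\prod_{a\in L_1,\,a\le l}x_a$, $l\in L$, ordered like $L$ (that is,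 $m(l)\le m(l')$ iff $l\le l'$), with rank $r(m(l))=r(l)$. Given $M_i$, choose (if possible) $m\in M_i$ and $a\in L_1$ such that $x_a\mid m$, $\frac{x_a}{x_b}m\in M_i$ for all $b\in L_1$ with $x_b\mid m$, and $x_am\notin M_i$. Obtain $M_{i+1}$ from $M_i$ by adding the element $x_am$, of rank $r(m)+1$, which covers exactly the elements $\frac{x_a}{x_b}m$ with $b\in L_1$, $x_b\mid m$. Repeat this finitely or countably many times and put $P=\bigcup_i M_i$; the family $\mathfrak P$ consists of all $P$ that arise in this way. Then: 1. Every $P\in\mathfrak P$, finite or infinite, has finitely many elements of each rank, has $f_{-1}=1$, and satisfies the Macaulay inequalities. 2. Every geometric meet semi-lattice is isomorphic, as a ranked poset, to a member of $\mathfrak P$ constructed from it. 3. Every multicomplex, i.e. every non-empty set $I$ of monomials in finitely many variables that contains all divisors of its elements, ordered by divisibility and ranked by degree, is isomorphic, as a ranked poset, to a member of $\mathfrak P$. -/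

import Mathlib

universe u

/-! ### Binomial expansions and the Macaulay operator -/

/-- `n = C(a k, k) + C(a (k-1), k-1) + ... + C(a i, i)` with
`a k > a (k-1) > ... > a i ≥ i ≥ 1`. -/
structure IsBinomialExpansion (k n i : ℕ) (a : ℕ → ℕ) : Prop where
  one_le : 1 ≤ i
  le_top : i ≤ k
  le_apply : i ≤ a i
  apply_lt : ∀ j, i ≤ j → j < k → a j < a (j + 1)
  eq_sum : n = ∑ j ∈ Finset.Icc i k, (a j).choose j

theorem IsBinomialExpansion.index_le {k n i : ℕ} {a : ℕ → ℕ}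
    (h : IsBinomialExpansion k n i a) (j : ℕ) (hij : i ≤ j) (hjk : j ≤ k) : j ≤ a j := by
  induction j, hij using Nat.le_induction with
  | base => exact h.le_apply
  | succ j hij ih =>
    have h1 := ih (by omega)
    have h2 := h.apply_lt j hij (by omega)
    omega

theorem IsBinomialExpansion.tail {k n i : ℕ} {a : ℕ → ℕ}
    (h : IsBinomialExpansion (k + 1) n i a) (hik : i ≤ k) :
    ∃ m, IsBinomialExpansion k m i a ∧ n = m + (a (k + 1)).choose (k + 1) := by
  refine ⟨_, ⟨h.one_le, hik, h.le_apply, fun j h1 h2 => h.apply_lt j h1 (by omega), rfl⟩, ?_⟩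
  rw [h.eq_sum, Finset.sum_Icc_succ_top (by omega)]

theorem IsBinomialExpansion.bounds {k n i : ℕ} {a : ℕ → ℕ} (h : IsBinomialExpansion k n i a) :
    (a k).choose k ≤ n ∧ n < (a k + 1).choose k := by
  induction k generalizing n with
  | zero => exact absurd (h.one_le.trans h.le_top) (by omega)
  | succ k ih =>
    have hk := h.index_le (k + 1) h.le_top le_rfl
    rw [Nat.choose_succ_succ']
    rcases Nat.lt_or_ge k i with hki | hki
    · have hi : i = k + 1 := le_antisymm h.le_top hki
      have hn : n = (a (k + 1)).choose (k + 1) := by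
        rw [h.eq_sum, hi, Finset.Icc_self, Finset.sum_singleton]
      have : 0 < (a (k + 1)).choose k := Nat.choose_pos (by omega)
      omega
    · obtain ⟨m, hm, hn⟩ := h.tail hki
      have h1 := (ih hm).2
      have h2 : (a k + 1).choose k ≤ (a (k + 1)).choose k :=
        Nat.choose_le_choose k (h.apply_lt k hki (by omega))
      omega

/-- The binomial expansion of a positive integer is unique. -/
theorem IsBinomialExpansion.unique {k n i i' : ℕ} {a a' : ℕ → ℕ}
    (h : IsBinomialExpansion k n i a) (h' : IsBinomialExpansion k n i' a') :
    i = i' ∧ ∀ j ∈ Finset.Icc i k, a j = a' j := by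
  induction k generalizing n with
  | zero => exact absurd (h.one_le.trans h.le_top) (by omega)
  | succ k ih =>
    have htop : a (k + 1) = a' (k + 1) := by
      obtain ⟨b1, b2⟩ := h.bounds
      obtain ⟨c1, c2⟩ := h'.bounds
      by_contra hne
      rcases Nat.lt_or_gt_of_ne hne with hlt | hlt
      · have := Nat.choose_le_choose (k + 1) (show a (k + 1) + 1 ≤ a' (k + 1) from hlt)
        omega
      · have := Nat.choose_le_choose (k + 1) (show a' (k + 1) + 1 ≤ a (k + 1) from hlt)
        omega
    have pos : ∀ {m l : ℕ} {c : ℕ → ℕ}, IsBinomialExpansion k m l c → 0 < m := by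
      intro m l c hc
      exact lt_of_lt_of_le (Nat.choose_pos (hc.index_le k hc.le_top le_rfl)) hc.bounds.1
    have single : ∀ {l : ℕ} {c : ℕ → ℕ}, IsBinomialExpansion (k + 1) n l c → k < l →
        l = k + 1 ∧ n = (c (k + 1)).choose (k + 1) := by
      intro l c hc hl
      have hl' : l = k + 1 := le_antisymm hc.le_top hl
      refine ⟨hl', ?_⟩
      rw [hc.eq_sum, hl', Finset.Icc_self, Finset.sum_singleton]
    rcases Nat.lt_or_ge k i with hi | hi <;> rcases Nat.lt_or_ge k i' with hi' | hi'
    · obtain ⟨e, -⟩ := single h hi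
      obtain ⟨e', -⟩ := single h' hi'
      refine ⟨e.trans e'.symm, fun j hj => ?_⟩
      rw [e, Finset.Icc_self, Finset.mem_singleton] at hj
      rw [hj, htop]
    · obtain ⟨-, e⟩ := single h hi
      obtain ⟨m, hm, e'⟩ := h'.tail hi'
      have := pos hm
      rw [htop] at e
      omega
    · obtain ⟨-, e⟩ := single h' hi'
      obtain ⟨m, hm, e'⟩ := h.tail hi
      have := pos hm
      rw [htop] at e'
      omega
    · obtain ⟨m, hm, e⟩ := h.tail hi
      obtain ⟨m', hm', e'⟩ := h'.tail hi'
      have hmm : m' = m := by rw [htop] at e; omega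
      subst hmm
      obtain ⟨e1, e2⟩ := ih hm hm'
      refine ⟨e1, fun j hj => ?_⟩
      rw [Finset.mem_Icc] at hj
      rcases Nat.lt_or_ge k j with hj' | hj'
      · have : j = k + 1 := by omega
        rw [this, htop]
      · exact e2 j (Finset.mem_Icc.2 ⟨hj.1, hj'⟩)

/-- Every positive integer has a binomial expansion. -/
theorem exists_isBinomialExpansion (k n : ℕ) (hk : 0 < k) (hn : 0 < n) :
    ∃ i a, IsBinomialExpansion k n i a := by
  induction k generalizing n with
  | zero => omega
  | succ k ih =>
    have hex : ∃ N, n < (N + 1).choose (k + 1) := by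
      refine ⟨n + k, ?_⟩
      rw [Nat.choose_symm_of_eq_add (show n + k + 1 = (k + 1) + n by omega)]
      have := Nat.choose_le_choose n (show n + 1 ≤ n + k + 1 by omega)
      rw [Nat.choose_symm_of_eq_add (show n + 1 = n + 1 from rfl), Nat.choose_one_right] at this
      omega
    classical
    obtain ⟨N, hN, hmin⟩ : ∃ N, n < (N + 1).choose (k + 1) ∧
        ∀ N' < N, ¬ n < (N' + 1).choose (k + 1) :=
      ⟨Nat.find hex, Nat.find_spec hex, fun _ h => Nat.find_min hex h⟩
    have hkN : k + 1 ≤ N := by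
      by_contra hlt
      have h1 : (N + 1).choose (k + 1) ≤ 1 := by
        calc (N + 1).choose (k + 1) ≤ (k + 1).choose (k + 1) :=
              Nat.choose_le_choose _ (by omega)
          _ = 1 := Nat.choose_self _
      omega
    have hle : N.choose (k + 1) ≤ n := by
      have := hmin (N - 1) (by omega)
      rw [Nat.sub_add_cancel (by omega)] at this
      omega
    rw [Nat.choose_succ_succ'] at hN
    rcases Nat.eq_zero_or_pos (n - N.choose (k + 1)) with h0 | hpos
    · refine ⟨k + 1, fun _ => N, by omega, le_rfl, hkN, fun j h1 h2 => by omega, ?_⟩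
      rw [Finset.Icc_self, Finset.sum_singleton]
      omega
    · have hk0 : 0 < k := by
        rcases Nat.eq_zero_or_pos k with rfl | h
        · rw [Nat.choose_zero_right] at hN
          omega
        · exact h
      obtain ⟨i, a, h⟩ := ih (n - N.choose (k + 1)) hk0 hpos
      have hlt : a k < N := by
        by_contra hge
        have := Nat.choose_le_choose k (show N ≤ a k by omega)
        have := h.bounds.1
        omega
      refine ⟨i, fun j => if j = k + 1 then N else a j, h.one_le, h.le_top.trans (by omega),
        ?_, ?_, ?_⟩
      · have := h.le_top
        rw [if_neg (by omega)]
        exact h.le_apply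
      · intro j h1 h2
        rw [if_neg (by omega)]
        rcases Nat.lt_or_ge j k with h3 | h3
        · rw [if_neg (by omega)]
          exact h.apply_lt j h1 h3
        · have : j = k := by omega
          rw [if_pos (by omega), this]
          exact hlt
      · have hle' := h.le_top
        rw [Finset.sum_Icc_succ_top (by omega), if_pos rfl]
        have : ∑ j ∈ Finset.Icc i k, (if j = k + 1 then N else a j).choose j
            = n - N.choose (k + 1) := by
          rw [h.eq_sum]
          refine Finset.sum_congr rfl fun j hj => ?_
          rw [Finset.mem_Icc] at hj
          rw [if_neg (by omega)]
        omega

open Classical in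
/-- The operator `∂^k`: if `n = ∑ C(a j, j)`, `i ≤ j ≤ k + 1`, is the binomial expansion of
`n > 0` of order `k + 1`, then `∂^k(n) = ∑ C(a j - 1, j - 1)`; moreover `∂^k(0) = 0`. -/
noncomputable def macaulayPartial (k n : ℕ) : ℕ :=
  if h : ∃ p : ℕ × (ℕ → ℕ), IsBinomialExpansion (k + 1) n p.1 p.2 then
    ∑ j ∈ Finset.Icc h.choose.1 (k + 1), (h.choose.2 j - 1).choose (j - 1)
  else 0

theorem macaulayPartial_eq {k n i : ℕ} {a : ℕ → ℕ} (h : IsBinomialExpansion (k + 1) n i a) :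
    macaulayPartial k n = ∑ j ∈ Finset.Icc i (k + 1), (a j - 1).choose (j - 1) := by
  have hex : ∃ p : ℕ × (ℕ → ℕ), IsBinomialExpansion (k + 1) n p.1 p.2 := ⟨(i, a), h⟩
  obtain ⟨e1, e2⟩ := h.unique hex.choose_spec
  rw [macaulayPartial, dif_pos hex, ← e1]
  exact Finset.sum_congr rfl fun j hj => by rw [e2 j hj]

theorem macaulayPartial_zero (k : ℕ) : macaulayPartial k 0 = 0 := by
  refine dif_neg ?_
  rintro ⟨p, hp⟩
  have h1 := Nat.choose_pos (hp.index_le (k + 1) hp.le_top le_rfl)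
  have h2 := hp.bounds.1
  omega

/-! ### Geometric meet semi-lattices -/

/-- A meet semi-lattice `L` with minimum, ranked by `grade ℕ` and finite at every rank, is
*geometric* if every element is a join of atoms and `r(x ∧ y) + r(x ∨ y) ≤ r(x) + r(y)` whenever
the join of `x` and `y` exists. -/
structure IsGeometricMeetSemilattice (L : Type u) [SemilatticeInf L] [OrderBot L]
    [GradeMinOrder ℕ L] : Prop where
  finite_rank : ∀ n : ℕ, {x : L | grade ℕ x = n}.Finite
  atomistic : IsAtomistic L
  rank_inf_add_rank_sup_le : ∀ x y z : L, IsLUB {x, y} z →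
    grade ℕ (x ⊓ y) + grade ℕ z ≤ grade ℕ x + grade ℕ y

/-- The atoms of `L`; they index the variables `x_a`. -/
abbrev Atoms (L : Type u) [PartialOrder L] [OrderBot L] : Type u := {a : L // IsAtom a}

/-! ### Ranked posets of monomials

A monomial in the variables `x_s`, `s ∈ σ`, is its exponent vector `σ →₀ ℕ`. -/

/-- A set of monomials together with a rank function and an order relation. The values of
`rank` outside `carrier` are irrelevant. -/
structure MonomialPoset (σ : Type u) where
  carrier : Set (σ →₀ ℕ)
  rank : (σ →₀ ℕ) → ℕ
  le : (σ →₀ ℕ) → (σ →₀ ℕ) → Prop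

namespace MonomialPoset

variable {σ : Type u}

/-- The elements of rank `j`. -/
def level (P : MonomialPoset σ) (j : ℕ) : Set (σ →₀ ℕ) :=
  {p | p ∈ P.carrier ∧ P.rank p = j}

/-- `P.levelCard j` is the entry `f_{j-1}` of the `f`-vector, the number of elements of
rank `j`. -/
noncomputable def levelCard (P : MonomialPoset σ) (j : ℕ) : ℕ := (P.level j).ncard

/-- The Macaulay inequalities `0 ≤ ∂^k(f_k) ≤ f_{k-1}` for all `k ≥ 0`. -/
def MacaulayInequalities (P : MonomialPoset σ) : Prop :=
  ∀ k : ℕ, 0 ≤ macaulayPartial k (P.levelCard (k + 1)) ∧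
    macaulayPartial k (P.levelCard (k + 1)) ≤ P.levelCard k

/-- `(x_a / x_b) m`, for a variable `x_b` dividing `m`. -/
noncomputable def exchange (m : σ →₀ ℕ) (a b : σ) : σ →₀ ℕ :=
  m + Finsupp.single a 1 - Finsupp.single b 1

open Classical in
/-- Adjoin the monomial `x_a m` to `M`: its rank is one more than that of `m`, and the elements
strictly below it are those below some `(x_a / x_b) m` with `x_b ∣ m`, so that it covers the
latter elements. -/
noncomputable def adjoin (M : MonomialPoset σ) (m : σ →₀ ℕ) (a : σ) : MonomialPoset σ where
  carrier := insert (m + Finsupp.single a 1) M.carrier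
  rank := Function.update M.rank (m + Finsupp.single a 1) (M.rank m + 1)
  le p q := M.le p q ∨ (q = m + Finsupp.single a 1 ∧
    (p = m + Finsupp.single a 1 ∨ ∃ b, m b ≠ 0 ∧ M.le p (exchange m a b)))

/-- `x_a m` may be adjoined to `M`: `m ∈ M`, `x_a ∣ m`, all `(x_a / x_b) m` with `x_b ∣ m` lie in
`M`, and `x_a m` does not. -/
structure CanAdjoin (M : MonomialPoset σ) (m : σ →₀ ℕ) (a : σ) : Prop where
  mem : m ∈ M.carrier
  dvd : m a ≠ 0
  exchange_mem : ∀ b, m b ≠ 0 → exchange m a b ∈ M.carrier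
  notMem : m + Finsupp.single a 1 ∉ M.carrier

/-- `P` is the union of the sequence `M 0 ⊆ M 1 ⊆ ...`. -/
structure IsUnion (M : ℕ → MonomialPoset σ) (P : MonomialPoset σ) : Prop where
  carrier_eq : P.carrier = ⋃ i, (M i).carrier
  rank_eq : ∀ i, ∀ p ∈ (M i).carrier, P.rank p = (M i).rank p
  le_iff : ∀ p q, P.le p q ↔ ∃ i, (M i).le p q

/-- `P` is isomorphic, as a ranked poset, to `α` with the rank function `r`. -/
def IsoTo (P : MonomialPoset σ) (α : Type u) [LE α] (r : α → ℕ) : Prop :=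
  ∃ e : α ≃ P.carrier, (∀ x y, x ≤ y ↔ P.le (e x) (e y)) ∧ ∀ x, P.rank (e x) = r x

end MonomialPoset

section Family

variable {L : Type u} [SemilatticeInf L] [OrderBot L]

open Classical in
/-- `m` is the square-free monomial `m(l)`, the product of the `x_a` over the atoms `a ≤ l`. -/
def IsAtomMonomial (l : L) (m : Atoms L →₀ ℕ) : Prop :=
  ∀ a : Atoms L, m a = if a.1 ≤ l then 1 else 0

variable [GradeMinOrder ℕ L]

/-- `M` is the collection `M₀` of all monomials `m(l)`, with the rank and the order of `L`. -/
structure IsInitial (M : MonomialPoset (Atoms L)) : Prop where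
  mem_carrier_iff : ∀ m, m ∈ M.carrier ↔ ∃ l : L, IsAtomMonomial l m
  rank_eq : ∀ (l : L) m, IsAtomMonomial l m → M.rank m = grade ℕ l
  le_iff : ∀ p q, M.le p q ↔ ∃ l l' : L, IsAtomMonomial l p ∧ IsAtomMonomial l' q ∧ l ≤ l'

variable (L) in
/-- The members of the family that are constructed from `L`: `P` is the union of a sequence
`M 0 ⊆ M 1 ⊆ ...` that starts with the monomials `m(l)` and in which each further term arises by
adjoining one monomial or is equal to its predecessor (so that finitely many adjunctions are
allowed as well as countably many). -/
def InFamily (P : MonomialPoset (Atoms L)) : Prop :=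
  ∃ M : ℕ → MonomialPoset (Atoms L), IsInitial (M 0) ∧
    (∀ i, M (i + 1) = M i ∨ ∃ m a, (M i).CanAdjoin m a ∧ M (i + 1) = (M i).adjoin m a) ∧
    MonomialPoset.IsUnion M P

end Family

/-! Every member of the family has the same rank numbers as an honest multicomplex, so Macaulay's
theorem applies to it. Let C be the set of monomials of P. By induction along the construction, the
square-free elements of C are exactly the m(l), and an element divisible by some x_a² stays in C
when divided by any of its variables (`IsMonomialExtension`). Dividing such an element by the other
variables one at a time gives a chain of elements of L that loses one atom at each drop. Hence the
atoms below the corresponding l are as many as its rank, and rank equals degree on the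
non-square-free part (`IsMonomialExtension.card_atomsBelow_le_grade`).

Now order the atoms and replace each m(l) by the product over the lexicographically first basis of
l. Semimodularity makes this product have degree r(l), and subsets of such bases are again such
bases (`exists_greedyBasis_eq`). Below a non-square-free monomial the basis consists of all atoms,
so nothing changes there, and the new set is closed under divisors (`isLowerSet_basisMulticomplex`).

Macaulay's theorem is proved by splitting a multicomplex into the monomials free of x_a and the link
of x_a. This reduces it to ∂(p + q) ≤ max(q, ∂p + ∂q), where the last ∂ has one degree less
(`macaulayShadow_add_le`). The numerical input is that, among windows of r consecutive integers, the
increment of the operator is largest on the first window and, inside a block of size `simplexCount a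
b`, smallest on the last (`macaulayShadow_subadditive_and_dual`).

For the converse statements, L itself needs no adjunction. A multicomplex is built from the face
poset of its square-free part by adding its other monomials in an order that respects divisibility.
-/

/-! ### Numerical properties of the Macaulay operator -/

/-- `simplexCount a b` is the number of monomials of degree `a` in `b + 1` variables. -/
def simplexCount (a b : ℕ) : ℕ := (a + b).choose a

theorem simplexCount_zero_left (b : ℕ) : simplexCount 0 b = 1 := by simp [simplexCount]

theorem simplexCount_zero_right (a : ℕ) : simplexCount a 0 = 1 := by simp [simplexCount]

theorem simplexCount_succ (a b : ℕ) :
    simplexCount (a + 1) (b + 1) = simplexCount (a + 1) b + simplexCount a (b + 1) := by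
  unfold simplexCount
  rw [show a + 1 + (b + 1) = (a + b + 1) + 1 by omega, Nat.choose_succ_succ',
    show a + 1 + b = a + b + 1 by omega, show a + (b + 1) = a + b + 1 by omega, add_comm]

theorem simplexCount_pos (a b : ℕ) : 0 < simplexCount a b :=
  Nat.choose_pos (Nat.le_add_right a b)

theorem simplexCount_mono_left {a a' : ℕ} (h : a ≤ a') (b : ℕ) :
    simplexCount a b ≤ simplexCount a' b := by
  unfold simplexCount
  rw [Nat.choose_symm_add, Nat.choose_symm_add]
  exact Nat.choose_le_choose b (by omega)

theorem le_simplexCount_one (a b : ℕ) : b < simplexCount (a + 1) b := by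
  have h := simplexCount_mono_left (show 1 ≤ a + 1 by omega) b
  have : simplexCount 1 b = b + 1 := by simp [simplexCount, add_comm]
  omega

/-- The Macaulay operator indexed by degree: `macaulayShadow (k + 1) = ∂^k`. -/
noncomputable def macaulayShadow : ℕ → ℕ → ℕ
  -- With this value the block recursion `macaulayShadow_add` also holds for `a = 0`, as ∂^0(n) = 1
  -- for all n > 0.
  | 0, _ => 0
  | k + 1, n => macaulayPartial k n

theorem macaulayShadow_zero_left (n : ℕ) : macaulayShadow 0 n = 0 := rfl

theorem macaulayShadow_zero (a : ℕ) : macaulayShadow a 0 = 0 := by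
  cases a with
  | zero => rfl
  | succ a => exact macaulayPartial_zero a

theorem macaulayShadow_simplexCount (a b : ℕ) :
    macaulayShadow (a + 1) (simplexCount (a + 1) b) = simplexCount a b := by
  have h : IsBinomialExpansion (a + 1) (simplexCount (a + 1) b) (a + 1)
      (fun _ => a + 1 + b) :=
    ⟨by omega, le_rfl, by omega, fun j h1 h2 => by omega, by
      rw [Finset.Icc_self, Finset.sum_singleton]; rfl⟩
  change macaulayPartial a _ = _
  rw [macaulayPartial_eq h, Finset.Icc_self, Finset.sum_singleton, simplexCount]
  congr 1
  omega

/-- For 0 < y below the bound, the expansion of y has a top entry less than a + 1 + b, so the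
binomial coefficient of the block can be put in front of it. At the bound itself the leading entry
jumps, and Pascal's rule gives the same value. Including the bound lets the blocks tile the
integers. -/
theorem macaulayShadow_add (a b y : ℕ) (hy : y ≤ simplexCount a (b + 1)) :
    macaulayShadow (a + 1) (simplexCount (a + 1) b + y) =
      simplexCount a b + macaulayShadow a y := by
  rcases Nat.eq_zero_or_pos y with rfl | hpos
  · rw [add_zero, macaulayShadow_simplexCount, macaulayShadow_zero, add_zero]
  rcases hy.eq_or_lt with rfl | hlt
  · rw [← simplexCount_succ, macaulayShadow_simplexCount]
    cases a with
    | zero => simp [simplexCount_zero_left, macaulayShadow_zero_left]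
    | succ a => rw [macaulayShadow_simplexCount, simplexCount_succ]
  cases a with
  | zero => rw [simplexCount_zero_left] at hlt; omega
  | succ a =>
    obtain ⟨i, f, h⟩ := exists_isBinomialExpansion (a + 1) y (by omega) hpos
    have hi := h.le_top
    have hf : f (a + 1) < a + 1 + (b + 1) := by
      by_contra hge
      have h1 := Nat.choose_le_choose (a + 1) (not_lt.1 hge)
      have h2 := h.bounds.1
      unfold simplexCount at hlt
      omega
    have h' : IsBinomialExpansion (a + 1 + 1) (simplexCount (a + 1 + 1) b + y) i
        (Function.update f (a + 1 + 1) (a + 1 + 1 + b)) := by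
      refine ⟨h.one_le, by omega, ?_, ?_, ?_⟩
      · rw [Function.update_of_ne (by omega)]
        exact h.le_apply
      · intro j h1 h2
        rw [Function.update_of_ne (by omega)]
        rcases Nat.lt_or_ge j (a + 1) with h3 | h3
        · rw [Function.update_of_ne (by omega)]
          exact h.apply_lt j h1 h3
        · obtain rfl : j = a + 1 := by omega
          rw [Function.update_self]
          omega
      · rw [Finset.sum_Icc_succ_top (by omega), Function.update_self, add_comm, h.eq_sum]
        congr 1
        refine Finset.sum_congr rfl fun j hj => ?_
        rw [Finset.mem_Icc] at hj
        rw [Function.update_of_ne (by omega)]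
    change macaulayPartial (a + 1) _ = _ + macaulayPartial a y
    rw [macaulayPartial_eq h', macaulayPartial_eq h, Finset.sum_Icc_succ_top (by omega),
      Function.update_self, add_comm]
    congr 1
    · unfold simplexCount
      congr 1
      omega
    · refine Finset.sum_congr rfl fun j hj => ?_
      rw [Finset.mem_Icc] at hj
      rw [Function.update_of_ne (by omega)]

theorem macaulayShadow_one (a : ℕ) : macaulayShadow (a + 1) 1 = 1 := by
  have h := macaulayShadow_simplexCount a 0
  rwa [simplexCount_zero_right, simplexCount_zero_right] at h

/-- Every `n ≥ 2` is the sum of a simplex count and a positive part of the next block. -/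
theorem exists_eq_simplexCount_add (a n : ℕ) (hn : 1 < n) :
    ∃ b y, 0 < y ∧ y ≤ simplexCount a (b + 1) ∧ n = simplexCount (a + 1) b + y := by
  classical
  have hex : ∃ b, n ≤ simplexCount (a + 1) b := ⟨n, (le_simplexCount_one a n).le⟩
  obtain ⟨b, hb, hmin⟩ : ∃ b, n ≤ simplexCount (a + 1) b ∧
      ∀ b' < b, ¬ n ≤ simplexCount (a + 1) b' :=
    ⟨Nat.find hex, Nat.find_spec hex, fun _ h => Nat.find_min hex h⟩
  cases b with
  | zero => rw [simplexCount_zero_right] at hb; omega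
  | succ b =>
    have h := hmin b (by omega)
    rw [simplexCount_succ] at hb
    exact ⟨b, n - simplexCount (a + 1) b, by omega, by omega, by omega⟩

/-- By the block recursion, the increments in degree a + 1 along a block are increments in degree a,
so induction on the degree applies. -/
theorem macaulayShadow_succ_bounds (a n : ℕ) :
    macaulayShadow a n ≤ macaulayShadow a (n + 1) ∧
      macaulayShadow a (n + 1) ≤ macaulayShadow a n + 1 := by
  induction a generalizing n with
  | zero => simp [macaulayShadow_zero_left]
  | succ a ih =>
    rcases Nat.eq_zero_or_pos n with rfl | hn
    · simp [macaulayShadow_zero, macaulayShadow_one]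
    · obtain ⟨b, y, hy, hyle, h⟩ := exists_eq_simplexCount_add a (n + 1) (by omega)
      obtain ⟨y, rfl⟩ : ∃ z, y = z + 1 := ⟨y - 1, by omega⟩
      obtain rfl : n = simplexCount (a + 1) b + y := by omega
      have := ih y
      rw [add_assoc, macaulayShadow_add a b y (by omega), macaulayShadow_add a b (y + 1) hyle]
      omega

theorem macaulayShadow_mono (a : ℕ) : Monotone (macaulayShadow a) :=
  monotone_nat_of_le_succ fun n => (macaulayShadow_succ_bounds a n).1

theorem macaulayShadow_le (a n : ℕ) : macaulayShadow a n ≤ n := by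
  induction n with
  | zero => rw [macaulayShadow_zero]
  | succ n ih => have := (macaulayShadow_succ_bounds a n).2; omega

/-- Peel off the last block S of n = S + y. Subadditivity bounds the value at n by the values at S
and y; the first grows with the degree by induction, and the second is already the contribution of y
in degree a + 1. Subadditivity is a hypothesis because this comparison is used inside the induction
that proves it. -/
theorem macaulayShadow_le_succ (a : ℕ)
    (hS : ∀ x y, macaulayShadow a (x + y) ≤ macaulayShadow a x + macaulayShadow a y) (n : ℕ) :
    macaulayShadow a n ≤ macaulayShadow (a + 1) n := by
  induction n using Nat.strong_induction_on with
  | _ n ih =>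
    rcases Nat.lt_or_ge 1 n with hn | hn
    · obtain ⟨b, y, hy, hyle, rfl⟩ := exists_eq_simplexCount_add a n hn
      have h1 := ih (simplexCount (a + 1) b) (by omega)
      have h2 := hS (simplexCount (a + 1) b) y
      rw [macaulayShadow_simplexCount] at h1
      rw [macaulayShadow_add a b y hyle]
      omega
    · interval_cases n
      · simp [macaulayShadow_zero]
      · rw [macaulayShadow_one]
        exact macaulayShadow_le a 1

/-- The block of degree a + 1 ends with a copy of the block of degree a in as many variables. So the
last r terms of both contribute the same amount. -/
theorem macaulayShadow_suffix (j a b r s t : ℕ) (hja : j ≤ a)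
    (hs : r + s = simplexCount j (b + 1)) (ht : r + t = simplexCount a (b + 1)) :
    macaulayShadow j (simplexCount j (b + 1)) + macaulayShadow a t =
      macaulayShadow a (simplexCount a (b + 1)) + macaulayShadow j s := by
  induction a, hja using Nat.le_induction generalizing t with
  | base =>
    obtain rfl : s = t := by omega
    rfl
  | succ a hja ih =>
    have hle := simplexCount_mono_left hja (b + 1)
    have e := simplexCount_succ a b
    obtain ⟨t, rfl⟩ : ∃ t', t = simplexCount (a + 1) b + t' :=
      ⟨t - simplexCount (a + 1) b, by omega⟩
    have := ih t (by omega)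
    rw [e, macaulayShadow_add a b t (by omega), macaulayShadow_add a b _ le_rfl]
    omega

/-- The last `r` terms of the block for degree `j ≤ a` contribute at most as much as the last
`r` terms of the block for degree `a + 1` with one variable fewer. -/
theorem macaulayShadow_suffix_le (a b : ℕ)
    (hT : ∀ x y z, x ≤ simplexCount (a + 1) b → y ≤ simplexCount (a + 1) b →
      x + y = simplexCount (a + 1) b + z →
      macaulayShadow (a + 1) (simplexCount (a + 1) b) + macaulayShadow (a + 1) z ≤
        macaulayShadow (a + 1) x + macaulayShadow (a + 1) y)
    (j : ℕ) (hj : j ≤ a) (r s t : ℕ) (hs : r + s = simplexCount j (b + 1))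
    (ht : r + t = simplexCount (a + 1) b) :
    macaulayShadow j (simplexCount j (b + 1)) + macaulayShadow (a + 1) t ≤
      macaulayShadow (a + 1) (simplexCount (a + 1) b) + macaulayShadow j s := by
  induction j generalizing r s t with
  | zero =>
    have := macaulayShadow_mono (a + 1) (show t ≤ simplexCount (a + 1) b by omega)
    simp only [macaulayShadow_zero_left]
    omega
  | succ j ih =>
    have e := simplexCount_succ j b
    rcases Nat.lt_or_ge (simplexCount j (b + 1)) r with hr | hr
    · obtain ⟨r', rfl⟩ : ∃ r', r = simplexCount j (b + 1) + r' :=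
        ⟨r - simplexCount j (b + 1), by omega⟩
      -- The suffix consists of the whole final part of the block and r' further terms. `h0` bounds
      -- the former by a suffix of the target block, `h2` identifies the latter with the last r'
      -- terms there, and `h1` shows that the two suffixes together contribute at most as much as
      -- one of length r.
      have h0 := ih (by omega) (simplexCount j (b + 1)) 0 (r' + t) (by omega) (by omega)
      have h1 := hT (simplexCount j (b + 1) + t) (r' + t) t (by omega) (by omega) (by omega)
      have h2 : macaulayShadow (j + 1) (simplexCount (j + 1) b) +
          macaulayShadow (a + 1) (simplexCount j (b + 1) + t) =
          macaulayShadow (a + 1) (simplexCount (a + 1) b) + macaulayShadow (j + 1) s := by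
        cases b with
        | zero =>
          have := simplexCount_zero_right (a + 1)
          have := simplexCount_pos j 1
          simp only [zero_add] at *
          omega
        | succ b =>
          exact macaulayShadow_suffix (j + 1) (a + 1) b r' s _ (by omega) (by omega) (by omega)
      rw [macaulayShadow_simplexCount] at h2
      rw [macaulayShadow_zero] at h0
      rw [e, macaulayShadow_add j b _ le_rfl]
      omega
    · obtain ⟨s, rfl⟩ : ∃ s', s = simplexCount (j + 1) b + s' :=
        ⟨s - simplexCount (j + 1) b, by omega⟩
      have := ih (by omega) r s t (by omega) ht
      rw [e, macaulayShadow_add j b _ le_rfl, macaulayShadow_add j b s (by omega)]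
      omega

/-- Subadditivity of the Macaulay operator, with the dual statement inside one block. -/
theorem macaulayShadow_subadditive_and_dual (a : ℕ) :
    (∀ x y, macaulayShadow a (x + y) ≤ macaulayShadow a x + macaulayShadow a y) ∧
    (∀ b x y z, x ≤ simplexCount a b → y ≤ simplexCount a b → x + y = simplexCount a b + z →
      macaulayShadow a (simplexCount a b) + macaulayShadow a z ≤
        macaulayShadow a x + macaulayShadow a y) := by
  induction a with
  | zero => simp [macaulayShadow_zero_left]
  | succ a iha =>
    obtain ⟨hS, hT⟩ := iha
    have hmono := macaulayShadow_le_succ a hS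
    -- Read increments over windows of consecutive integers: the first clause says that no window
    -- beats the initial one of its length, the second that none inside the block falls below the
    -- final one. Both are proved by induction on b, splitting the block into a block with one
    -- variable fewer and one of degree a.
    have key : ∀ b, (∀ x y, x + y ≤ simplexCount (a + 1) b →
        macaulayShadow (a + 1) (x + y) ≤ macaulayShadow (a + 1) x + macaulayShadow (a + 1) y) ∧
        (∀ x y z, x ≤ simplexCount (a + 1) b → y ≤ simplexCount (a + 1) b →
          x + y = simplexCount (a + 1) b + z →
          macaulayShadow (a + 1) (simplexCount (a + 1) b) + macaulayShadow (a + 1) z ≤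
          macaulayShadow (a + 1) x + macaulayShadow (a + 1) y) := by
      intro b
      induction b with
      | zero =>
        simp only [simplexCount_zero_right]
        constructor
        · intro x y h
          rcases Nat.eq_zero_or_pos x with rfl | hx
          · simp
          · obtain rfl : y = 0 := by omega
            simp
        · intro x y z hx hy h
          rcases Nat.lt_or_ge x 1 with h1 | h1
          · obtain ⟨rfl, rfl, rfl⟩ : x = 0 ∧ y = 1 ∧ z = 0 := by omega
            omega
          · obtain ⟨rfl, rfl⟩ : x = 1 ∧ y = z := by omega
            omega
      | succ b ihb =>
        obtain ⟨ihS, ihT⟩ := ihb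
        have hsuf := macaulayShadow_suffix_le a b ihT a le_rfl
        have e := simplexCount_succ a b
        have hadd := macaulayShadow_add a b
        have hX := macaulayShadow_simplexCount a b
        have hYle := hadd _ le_rfl
        rw [e]
        constructor
        · intro x y hxy
          rcases Nat.lt_or_ge (simplexCount (a + 1) b) (x + y) with h | h
          · obtain ⟨w, hw⟩ : ∃ w, x + y = simplexCount (a + 1) b + w :=
              ⟨x + y - simplexCount (a + 1) b, by omega⟩
            rw [hw, hadd w (by omega)]
            rcases Nat.lt_or_ge x (simplexCount (a + 1) b) with hx | hx
            · rcases Nat.lt_or_ge y (simplexCount (a + 1) b) with hy | hy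
              · have h1 := ihT x y w hx.le hy.le hw
                have h2 := hmono w
                omega
              · obtain ⟨y, rfl⟩ : ∃ y', y = simplexCount (a + 1) b + y' :=
                  ⟨y - simplexCount (a + 1) b, by omega⟩
                obtain rfl : w = x + y := by omega
                have h1 := hS x y
                have h2 := hmono x
                rw [hadd y (by omega)]
                omega
            · obtain ⟨x, rfl⟩ : ∃ x', x = simplexCount (a + 1) b + x' :=
                ⟨x - simplexCount (a + 1) b, by omega⟩
              obtain rfl : w = x + y := by omega
              have h1 := hS x y
              have h2 := hmono y
              rw [hadd x (by omega)]
              omega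
          · exact ihS x y h
        -- The last r = x - z terms of the upper part contribute at most as much as the last r terms
        -- of the lower part, hence at most as much as the window from z to x there.
        · have mixed : ∀ x y z, x ≤ simplexCount (a + 1) b → y ≤ simplexCount a (b + 1) →
              x + y = simplexCount a (b + 1) + z →
              macaulayShadow a (simplexCount a (b + 1)) + macaulayShadow (a + 1) z ≤
              macaulayShadow (a + 1) x + macaulayShadow a y := by
            intro x y z hx hy hz
            obtain ⟨r, hr⟩ : ∃ r, r + z = x := ⟨x - z, by omega⟩
            have h1 := hsuf r y (simplexCount (a + 1) b - r) (by omega) (by omega)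
            have h2 := ihT x (simplexCount (a + 1) b - r) z hx (by omega) (by omega)
            omega
          intro x y z hx hy hz
          rw [hYle]
          rcases Nat.lt_or_ge x (simplexCount (a + 1) b) with hx' | hx'
          · rcases Nat.lt_or_ge y (simplexCount (a + 1) b) with hy' | hy'
            · obtain ⟨w, hw⟩ : ∃ w, x + y = simplexCount (a + 1) b + w :=
                ⟨x + y - simplexCount (a + 1) b, by omega⟩
              have h1 := ihT x y w hx'.le hy'.le hw
              have h2 := mixed w 0 z (by omega) (by omega) (by omega)
              rw [macaulayShadow_zero] at h2
              omega
            · obtain ⟨y, rfl⟩ : ∃ y', y = simplexCount (a + 1) b + y' :=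
                ⟨y - simplexCount (a + 1) b, by omega⟩
              have h1 := mixed x y z hx'.le (by omega) (by omega)
              rw [hadd y (by omega)]
              omega
          · obtain ⟨x, rfl⟩ : ∃ x', x = simplexCount (a + 1) b + x' :=
              ⟨x - simplexCount (a + 1) b, by omega⟩
            rw [hadd x (by omega)]
            rcases Nat.lt_or_ge y (simplexCount (a + 1) b) with hy' | hy'
            · have h1 := mixed y x z hy'.le (by omega) (by omega)
              omega
            · obtain ⟨y, rfl⟩ : ∃ y', y = simplexCount (a + 1) b + y' :=
                ⟨y - simplexCount (a + 1) b, by omega⟩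
              rw [hadd y (by omega)]
              rcases Nat.lt_or_ge (x + y) (simplexCount a (b + 1)) with h | h
              · have h1 := hS x y
                have h2 := hsuf (simplexCount a (b + 1) - (x + y)) (x + y) z (by omega)
                  (by omega)
                omega
              · obtain ⟨w, hw⟩ : ∃ w, x + y = simplexCount a (b + 1) + w :=
                  ⟨x + y - simplexCount a (b + 1), by omega⟩
                have h1 := hT (b + 1) x y w (by omega) (by omega) hw
                obtain rfl : z = simplexCount (a + 1) b + w := by omega
                rw [hadd w (by omega)]
                omega
    -- Subadditivity needs only some block containing x + y; `b = x + y` is large enough.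
    refine ⟨fun x y => (key (x + y)).1 x y (le_simplexCount_one a (x + y)).le,
      fun b => (key b).2⟩

/-- The numerical recursion behind Macaulay's theorem. -/
theorem macaulayShadow_add_le (a p q : ℕ) :
    macaulayShadow (a + 1) (p + q) ≤
      max q (macaulayShadow (a + 1) p + macaulayShadow a q) := by
  suffices h : q < macaulayShadow (a + 1) (p + q) →
      macaulayShadow (a + 1) (p + q) ≤ macaulayShadow (a + 1) p + macaulayShadow a q by
    rcases Nat.lt_or_ge q (macaulayShadow (a + 1) (p + q)) with hq | hq
    · exact (h hq).trans (le_max_right _ _)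
    · exact hq.trans (le_max_left _ _)
  induction a generalizing p q with
  | zero =>
    intro hq
    rcases Nat.eq_zero_or_pos q with rfl | h0
    · simp
    · have h1 := simplexCount_zero_left (p + q - 1)
      have h2 := macaulayShadow_simplexCount 0 (p + q - 1)
      have h3 : simplexCount 1 (p + q - 1) = p + q := by
        simp only [simplexCount, Nat.choose_one_right]; omega
      rw [zero_add, h3, h1] at h2
      simp only [zero_add] at *
      omega
  | succ a ih =>
    intro hq
    rcases Nat.lt_or_ge 1 (p + q) with hn | hn
    · obtain ⟨b, n, hn0, hnle, h⟩ := exists_eq_simplexCount_add (a + 1) (p + q) hn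
      have hD := macaulayShadow_add (a + 1) b n hnle
      rw [h, hD] at hq ⊢
      obtain ⟨hS, hT⟩ := macaulayShadow_subadditive_and_dual (a + 1)
      rcases Nat.lt_or_ge p (simplexCount (a + 1 + 1) b) with hp | hp
      · have hnn := macaulayShadow_le (a + 1) n
        cases b with
        | zero =>
          simp only [simplexCount_zero_right] at *
          omega
        | succ b =>
          have e := simplexCount_succ (a + 1) b
          have e' := simplexCount_succ a b
          -- The assumption that q is below the value at p + q, together with `hnn`, forces p past
          -- the preceding block.
          obtain ⟨p, rfl⟩ : ∃ p', p = simplexCount (a + 1 + 1) b + p' :=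
            ⟨p - simplexCount (a + 1 + 1) b, by omega⟩
          rw [macaulayShadow_add (a + 1) b p (by omega)]
          rcases Nat.lt_or_ge n p with hnp | hnp
          · have h1 := hT (b + 1) p q n (by omega) (by omega) (by omega)
            rw [macaulayShadow_simplexCount] at h1
            omega
          -- Here q fills a whole block of degree a + 1. Removing it leaves the same problem one
          -- degree lower, with the strict inequality preserved.
          · obtain ⟨q, rfl⟩ : ∃ q', q = simplexCount (a + 1) (b + 1) + q' :=
              ⟨q - simplexCount (a + 1) (b + 1), by omega⟩
            obtain rfl : n = p + q := by omega
            have h1 := ih p q (by omega)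
            have h2 := macaulayShadow_mono (a + 1) hnle
            rw [macaulayShadow_simplexCount] at h2
            rw [macaulayShadow_add a (b + 1) q (by omega)]
            omega
      · obtain ⟨p, rfl⟩ : ∃ p', p = simplexCount (a + 1 + 1) b + p' :=
          ⟨p - simplexCount (a + 1 + 1) b, by omega⟩
        obtain rfl : n = p + q := by omega
        have := hS p q
        rw [macaulayShadow_add (a + 1) b p (by omega)]
        omega
    · have := macaulayShadow_le (a + 1 + 1) (p + q)
      obtain rfl : q = 0 := by omega
      simp

/-! ### Macaulay's theorem for multicomplexes -/

/-- The monomials of degree `j` in `I`. -/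
def degreeLevel {σ : Type*} (I : Set (σ →₀ ℕ)) (j : ℕ) : Set (σ →₀ ℕ) :=
  {m | m ∈ I ∧ m.degree = j}

theorem finite_degreeLevel {σ : Type*} {I : Set (σ →₀ ℕ)} {s : Finset σ}
    (hs : ∀ m ∈ I, m.support ⊆ s) (j : ℕ) : (degreeLevel I j).Finite := by
  classical
  refine (Finset.finite_toSet (Finset.finsuppAntidiag s j)).subset fun m hm => ?_
  rw [Finset.mem_coe, Finset.mem_finsuppAntidiag]
  refine ⟨?_, hs m hm.1⟩
  rw [← hm.2, Finsupp.degree_apply]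
  exact (Finset.sum_subset (hs m hm.1) fun a _ ha => Finsupp.notMem_support_iff.1 ha).symm

/-- A monomial either avoids x_a or is x_a times a unique element of the link of x_a. -/
theorem ncard_degreeLevel_succ {σ : Type*} {I : Set (σ →₀ ℕ)} {s : Finset σ}
    (hs : ∀ m ∈ I, m.support ⊆ s) (a : σ) (j : ℕ) :
    (degreeLevel I (j + 1)).ncard = (degreeLevel {m | m ∈ I ∧ m a = 0} (j + 1)).ncard +
      (degreeLevel {m | m + Finsupp.single a 1 ∈ I} j).ncard := by
  have hinj : Function.Injective fun m : σ →₀ ℕ => m + Finsupp.single a 1 :=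
    add_left_injective _
  rw [← Set.ncard_image_of_injective (degreeLevel {m | m + Finsupp.single a 1 ∈ I} j) hinj,
    ← Set.ncard_union_eq ?_ ?_ ?_]
  · congr 1
    ext m
    constructor
    · rintro ⟨h1, h2⟩
      by_cases ha : m a = 0
      · exact Or.inl ⟨⟨h1, ha⟩, h2⟩
      · have hle : Finsupp.single a 1 ≤ m := by
          rw [Finsupp.single_le_iff]; omega
        have hm := tsub_add_cancel_of_le hle
        refine Or.inr ⟨m - Finsupp.single a 1, ⟨?_, ?_⟩, hm⟩
        · change _ + _ ∈ I
          rwa [hm]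
        · have := congrArg Finsupp.degree hm
          rw [map_add, Finsupp.degree_single] at this
          omega
    · rintro (⟨⟨h1, h2⟩, h3⟩ | ⟨m, ⟨h1, h2⟩, rfl⟩)
      · exact ⟨h1, h3⟩
      · refine ⟨h1, ?_⟩
        change Finsupp.degree (m + Finsupp.single a 1) = _
        rw [map_add, Finsupp.degree_single, h2]
  · rw [Set.disjoint_left]
    rintro _ ⟨⟨-, h⟩, -⟩ ⟨m, -, rfl⟩
    simp at h
  · exact finite_degreeLevel (s := s) (fun m hm => hs m hm.1) _
  · refine Set.Finite.image _ (finite_degreeLevel (s := s) (fun m hm => ?_) _)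
    refine (Finsupp.support_mono ?_).trans (hs _ hm)
    exact le_self_add

/-- **Macaulay's theorem** (necessity) for multicomplexes in finitely many variables. -/
theorem macaulayShadow_degreeLevel_le {σ : Type*} (j : ℕ) (s : Finset σ) (I : Set (σ →₀ ℕ))
    (hI : IsLowerSet I) (hs : ∀ m ∈ I, m.support ⊆ s) :
    macaulayShadow (j + 1) (degreeLevel I (j + 1)).ncard ≤ (degreeLevel I j).ncard := by
  classical
  induction j generalizing s I with
  | zero =>
    rcases Set.eq_empty_or_nonempty (degreeLevel I (0 + 1)) with h | ⟨m, hm, -⟩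
    · simp [h, macaulayShadow_zero]
    · have h0 : degreeLevel I 0 = {0} := by
        ext p
        constructor
        · rintro ⟨-, hp⟩
          exact (Finsupp.degree_eq_zero_iff p).1 hp
        · rintro rfl
          exact ⟨hI (zero_le) hm, map_zero _⟩
      -- In degree 1 every block has shadow 1, so it suffices to exceed the level by a block.
      obtain ⟨b, hb⟩ : ∃ b, simplexCount (0 + 1) b = (degreeLevel I (0 + 1)).ncard + 1 :=
        ⟨(degreeLevel I (0 + 1)).ncard, by simp [simplexCount, add_comm]⟩
      have h2 := macaulayShadow_simplexCount 0 b
      have h3 := macaulayShadow_mono (0 + 1)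
        (show (degreeLevel I (0 + 1)).ncard ≤ simplexCount (0 + 1) b by omega)
      rw [h2, simplexCount_zero_left] at h3
      rw [h0, Set.ncard_singleton]
      exact h3
  | succ j ihj =>
    induction s using Finset.induction_on generalizing I with
    | empty =>
      have h : degreeLevel I (j + 1 + 1) = ∅ := by
        rw [Set.eq_empty_iff_forall_notMem]
        rintro m ⟨hm, hd⟩
        have := hs m hm
        rw [Finset.subset_empty, Finsupp.support_eq_empty] at this
        rw [this, map_zero] at hd
        omega
      rw [h, Set.ncard_empty, macaulayShadow_zero]
      exact Nat.zero_le _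
    | insert a s ha ihs =>
      have hlink : IsLowerSet {m | m + Finsupp.single a 1 ∈ I} :=
        fun m m' h hm => hI (add_le_add_left h _) hm
      have hlinks : ∀ m ∈ {m | m + Finsupp.single a 1 ∈ I}, m.support ⊆ insert a s :=
        fun m hm => (Finsupp.support_mono le_self_add).trans (hs _ hm)
      have hdel : IsLowerSet {m | m ∈ I ∧ m a = 0} := fun m m' h hm =>
        ⟨hI h hm.1, Nat.le_zero.1 (hm.2 ▸ h a)⟩
      have h1 := ihs {m | m ∈ I ∧ m a = 0} hdel (fun m hm b hb => by
        rcases Finset.mem_insert.1 (hs m hm.1 hb) with rfl | h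
        · exact absurd hm.2 (Finsupp.mem_support_iff.1 hb)
        · exact h)
      have h2 := ihj (insert a s) _ hlink hlinks
      have h3 : (degreeLevel {m | m + Finsupp.single a 1 ∈ I} (j + 1)).ncard ≤
          (degreeLevel I (j + 1)).ncard :=
        Set.ncard_le_ncard (fun m hm => ⟨hI le_self_add hm.1, hm.2⟩) (finite_degreeLevel hs _)
      have h4 := ncard_degreeLevel_succ hs a j
      rw [ncard_degreeLevel_succ hs a (j + 1)]
      -- The link lies in I, which settles the first term of the maximum. The second is bounded by
      -- the inductive estimates for deletion and link, whose sum is the level of I.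
      refine (macaulayShadow_add_le (j + 1) _ _).trans (max_le h3 ?_)
      omega

theorem finite_degreeLevel_of_finite {σ : Type*} [Finite σ] (I : Set (σ →₀ ℕ)) (j : ℕ) :
    (degreeLevel I j).Finite := by
  have := Fintype.ofFinite σ
  exact finite_degreeLevel (s := Finset.univ) (fun m _ => Finset.subset_univ _) j

theorem macaulayPartial_degreeLevel_le {σ : Type*} [Finite σ] (j : ℕ) (I : Set (σ →₀ ℕ))
    (hI : IsLowerSet I) :
    macaulayPartial j (degreeLevel I (j + 1)).ncard ≤ (degreeLevel I j).ncard := by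
  have := Fintype.ofFinite σ
  exact macaulayShadow_degreeLevel_le j Finset.univ I hI fun m _ => Finset.subset_univ _

/-! ### Lexicographically first bases in a geometric meet semi-lattice -/

section GreedyBasis

variable {L : Type*} [SemilatticeInf L] [OrderBot L]

/-- The set of elements of `L` underlying a finite set of atoms. -/
def atomSet (S : Finset (Atoms L)) : Set L := Subtype.val '' (S : Set (Atoms L))

theorem mem_upperBounds_atomSet {S : Finset (Atoms L)} {u : L} :
    u ∈ upperBounds (atomSet S) ↔ ∀ a ∈ S, a.1 ≤ u := by
  simp [atomSet, upperBounds]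

theorem isLUB_atomSet_iff {S : Finset (Atoms L)} {z : L} :
    IsLUB (atomSet S) z ↔ ∀ u, z ≤ u ↔ ∀ a ∈ S, a.1 ≤ u := by
  rw [isLUB_iff_le_iff]
  simp only [mem_upperBounds_atomSet]

theorem atomSet_insert [DecidableEq (Atoms L)] (a : Atoms L) (S : Finset (Atoms L)) :
    atomSet (insert a S) = insert a.1 (atomSet S) := by
  simp [atomSet, Set.image_insert_eq]

theorem IsLUB.atomSet_insert_of_le [DecidableEq (Atoms L)] {S : Finset (Atoms L)}
    {a : Atoms L} {z z' : L} (hz : IsLUB (atomSet S) z) (hz' : IsLUB (atomSet (insert a S)) z')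
    (haz : a.1 ≤ z) : z' = z := by
  rw [isLUB_atomSet_iff] at hz hz'
  refine le_antisymm ((hz' z).2 fun b hb => ?_) ((hz z').2 fun b hb => ?_)
  · rcases Finset.mem_insert.1 hb with rfl | hb
    · exact haz
    · exact (hz z).1 le_rfl b hb
  · exact (hz' z').1 le_rfl b (Finset.mem_insert_of_mem hb)

theorem isLUB_atomSet_empty_iff {z : L} : IsLUB (atomSet (∅ : Finset (Atoms L))) z ↔ z = ⊥ := by
  simp only [isLUB_atomSet_iff, Finset.notMem_empty, false_imp_iff, implies_true, iff_true]
  exact ⟨fun h => le_bot_iff.1 (h ⊥), fun h u => h ▸ bot_le⟩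

open Classical in
/-- The atoms of `S` that are not below the join of the atoms of `S` preceding them in the order
given by `e`. -/
noncomputable def greedySubset (e : Atoms L → ℕ) (S : Finset (Atoms L)) : Finset (Atoms L) :=
  {a ∈ S | ∃ z : L, (∀ c ∈ S, e c < e a → c.1 ≤ z) ∧ ¬ a.1 ≤ z}

theorem mem_greedySubset {e : Atoms L → ℕ} {S : Finset (Atoms L)} {a : Atoms L} :
    a ∈ greedySubset e S ↔ a ∈ S ∧ ∃ z : L, (∀ c ∈ S, e c < e a → c.1 ≤ z) ∧ ¬ a.1 ≤ z := by
  simp [greedySubset]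

theorem greedySubset_subset (e : Atoms L → ℕ) (S : Finset (Atoms L)) : greedySubset e S ⊆ S :=
  fun _ h => (mem_greedySubset.1 h).1

/-- The atoms below `l`. -/
noncomputable def atomsBelow [Finite (Atoms L)] (l : L) : Finset (Atoms L) := (Set.toFinite {a | a.1 ≤ l}).toFinset

theorem mem_atomsBelow [Finite (Atoms L)] {l : L} {a : Atoms L} : a ∈ atomsBelow l ↔ a.1 ≤ l := by
  simp [atomsBelow]

/-- The lexicographically first basis of `l`. -/
noncomputable def greedyBasis [Finite (Atoms L)] (e : Atoms L → ℕ) (l : L) : Finset (Atoms L) :=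
  greedySubset e (atomsBelow l)

variable [GradeMinOrder ℕ L]

theorem grade_nat_bot : grade ℕ (⊥ : L) = 0 := grade_bot

theorem IsAtom.grade_nat {a : L} (ha : IsAtom a) : grade ℕ a = 1 := by
  have h := (bot_covBy_iff.2 ha).grade ℕ
  rw [grade_nat_bot] at h
  exact (Nat.covBy_iff_add_one_eq.1 h).symm

theorem IsGeometricMeetSemilattice.finite_atoms (hL : IsGeometricMeetSemilattice L) : Finite (Atoms L) :=
  Set.Finite.to_subtype ((hL.finite_rank 1).subset fun _ ha => IsAtom.grade_nat ha)

theorem IsGeometricMeetSemilattice.finite_Iic (hL : IsGeometricMeetSemilattice L)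
    (l : L) : (Set.Iic l).Finite := by
  refine ((Set.finite_Iic (grade ℕ l)).biUnion fun n _ => hL.finite_rank n).subset ?_
  intro x hx
  simp only [Set.mem_iUnion]
  exact ⟨grade ℕ x, Set.mem_Iic.2 (grade_mono (Set.mem_Iic.1 hx)), rfl⟩

/-- Only finitely many upper bounds lie below u, and their meet is the join. -/
theorem IsGeometricMeetSemilattice.exists_isLUB (hL : IsGeometricMeetSemilattice L)
    {S : Set L} {u : L} (hu : u ∈ upperBounds S) :
    ∃ z, IsLUB S z := by
  have hfin : (upperBounds S ∩ Set.Iic u).Finite :=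
    (hL.finite_Iic u).subset Set.inter_subset_right
  have hne : hfin.toFinset.Nonempty := ⟨u, by simpa using hu⟩
  refine ⟨hfin.toFinset.inf' hne id, ?_, ?_⟩
  · intro x hx
    refine Finset.le_inf' _ _ fun y hy => ?_
    rw [Set.Finite.mem_toFinset] at hy
    exact hy.1 hx
  · intro v hv
    have hvu : v ⊓ u ∈ hfin.toFinset := by
      rw [Set.Finite.mem_toFinset]
      exact ⟨fun x hx => le_inf (hv hx) (hu hx), inf_le_right⟩
    exact (Finset.inf'_le id hvu).trans inf_le_left

/-- Semimodularity for z and an atom allows the rank to rise by at most one, and strictness of the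
inequality z < z' makes it rise. -/
theorem IsGeometricMeetSemilattice.grade_isLUB_insert (hL : IsGeometricMeetSemilattice L)
    {S : Set L} {a z z' : L} (ha : IsAtom a)
    (hz : IsLUB S z) (hz' : IsLUB (insert a S) z') (haz : ¬ a ≤ z) :
    grade ℕ z' = grade ℕ z + 1 := by
  have hzz : z ≤ z' := hz.2 fun x hx => hz'.1 (Set.mem_insert_of_mem a hx)
  have haz' : a ≤ z' := hz'.1 (Set.mem_insert a S)
  have hlt : z < z' := lt_of_le_of_ne hzz fun h => haz (h ▸ haz')
  have hlub : IsLUB {z, a} z' := by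
    refine ⟨?_, fun v hv => hz'.2 ?_⟩
    · rintro x (rfl | rfl)
      · exact hzz
      · exact haz'
    · rintro x (rfl | hx)
      · exact hv (Or.inr rfl)
      · exact (hz.1 hx).trans (hv (Or.inl rfl))
  have h1 := hL.rank_inf_add_rank_sup_le z a z' hlub
  have h2 : grade ℕ z < grade ℕ z' := grade_strictMono hlt
  rw [ha.grade_nat] at h1
  omega

theorem IsGeometricMeetSemilattice.exists_isLUB_atomSet (hL : IsGeometricMeetSemilattice L)
    {S : Finset (Atoms L)} {u : L} (hu : ∀ a ∈ S, a.1 ≤ u) : ∃ z, IsLUB (atomSet S) z :=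
  hL.exists_isLUB (mem_upperBounds_atomSet.2 hu)

theorem IsGeometricMeetSemilattice.grade_le_card (hL : IsGeometricMeetSemilattice L)
    (S : Finset (Atoms L)) {z : L} (hz : IsLUB (atomSet S) z) : grade ℕ z ≤ S.card := by
  classical
  induction S using Finset.induction_on generalizing z with
  | empty => rw [isLUB_atomSet_empty_iff.1 hz, grade_nat_bot, Finset.card_empty]
  | insert a S ha ih =>
    obtain ⟨w, hw⟩ := hL.exists_isLUB_atomSet (S := S) (u := z) fun b hb =>
      (isLUB_atomSet_iff.1 hz z).1 le_rfl b (Finset.mem_insert_of_mem hb)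
    have h := ih hw
    rw [Finset.card_insert_of_notMem ha]
    by_cases haw : a.1 ≤ w
    · rw [hw.atomSet_insert_of_le hz haw]
      omega
    · rw [atomSet_insert] at hz
      rw [hL.grade_isLUB_insert a.2 hw hz haw]
      omega

/-- The greedy algorithm, by induction on S with the largest atom added last: this atom does not
affect earlier choices, and it is chosen exactly when it raises the join, hence the rank by one. -/
theorem IsGeometricMeetSemilattice.greedySubset_spec (hL : IsGeometricMeetSemilattice L)
    {e : Atoms L → ℕ} (he : Function.Injective e) (S : Finset (Atoms L)) {z : L}
    (hz : IsLUB (atomSet S) z) :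
    (greedySubset e S).card = grade ℕ z ∧ IsLUB (atomSet (greedySubset e S)) z := by
  classical
  induction S using Finset.induction_on_max_value e generalizing z with
  | empty =>
    have h : greedySubset e ∅ = (∅ : Finset (Atoms L)) :=
      Finset.subset_empty.1 (greedySubset_subset e ∅)
    rw [h]
    refine ⟨?_, hz⟩
    rw [isLUB_atomSet_empty_iff.1 hz, grade_nat_bot, Finset.card_empty]
  | insert a S ha hmax ih =>
    obtain ⟨w, hw⟩ := hL.exists_isLUB_atomSet (S := S) (u := z) fun b hb =>
      (isLUB_atomSet_iff.1 hz z).1 le_rfl b (Finset.mem_insert_of_mem hb)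
    obtain ⟨h1, h2⟩ := ih hw
    have hold : ∀ b ∈ S, b ∈ greedySubset e (insert a S) ↔ b ∈ greedySubset e S := by
      intro b hb
      simp only [mem_greedySubset, hb, Finset.mem_insert_of_mem hb, true_and,
        Finset.forall_mem_insert, (hmax b hb).not_gt, false_imp_iff]
    have hlt : ∀ c ∈ S, e c < e a := fun c hc =>
      lt_of_le_of_ne (hmax c hc) fun h => ha (he h ▸ hc)
    by_cases haw : a.1 ≤ w
    · have h : greedySubset e (insert a S) = greedySubset e S := by
        ext b
        refine ⟨fun hb => ?_, fun hb => (hold b (greedySubset_subset e S hb)).2 hb⟩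
        rcases Finset.mem_insert.1 (greedySubset_subset e _ hb) with rfl | hbS
        · obtain ⟨-, v, hv, hbv⟩ := mem_greedySubset.1 hb
          refine absurd (haw.trans ((isLUB_atomSet_iff.1 hw v).2 fun c hc => ?_)) hbv
          exact hv c (Finset.mem_insert_of_mem hc) (hlt c hc)
        · exact (hold b hbS).1 hb
      rw [h, hw.atomSet_insert_of_le hz haw]
      exact ⟨h1, h2⟩
    · have h : greedySubset e (insert a S) = insert a (greedySubset e S) := by
        ext b
        rw [Finset.mem_insert]
        constructor
        · intro hb
          rcases Finset.mem_insert.1 (greedySubset_subset e _ hb) with rfl | hbS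
          · exact Or.inl rfl
          · exact Or.inr ((hold b hbS).1 hb)
        · rintro (rfl | hb)
          · refine mem_greedySubset.2 ⟨Finset.mem_insert_self _ _, w, fun c hc hcb => ?_, haw⟩
            rcases Finset.mem_insert.1 hc with rfl | hc
            · exact absurd hcb (lt_irrefl _)
            · exact (isLUB_atomSet_iff.1 hw w).1 le_rfl c hc
          · exact (hold b (greedySubset_subset e S hb)).2 hb
      have hz' := hz
      rw [atomSet_insert] at hz'
      rw [h, Finset.card_insert_of_notMem fun h' => ha (greedySubset_subset e S h'), h1,
        hL.grade_isLUB_insert a.2 hw hz' haw]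
      refine ⟨rfl, ?_⟩
      rw [isLUB_atomSet_iff] at hz h2 hw ⊢
      intro u
      rw [hz, Finset.forall_mem_insert, Finset.forall_mem_insert, ← h2, hw]

variable [Finite (Atoms L)]

theorem IsGeometricMeetSemilattice.isLUB_atomsBelow (hL : IsGeometricMeetSemilattice L) (l : L) :
    IsLUB (atomSet (atomsBelow l)) l := by
  obtain ⟨S, hS, hat⟩ := hL.atomistic.isLUB_atoms l
  refine ⟨mem_upperBounds_atomSet.2 fun a ha => mem_atomsBelow.1 ha, fun u hu => hS.2 ?_⟩
  rw [mem_upperBounds_atomSet] at hu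
  exact fun a ha => hu ⟨a, hat a ha⟩ (mem_atomsBelow.2 (hS.1 ha))

theorem IsGeometricMeetSemilattice.atomsBelow_injective (hL : IsGeometricMeetSemilattice L) :
    Function.Injective (atomsBelow : L → Finset (Atoms L)) := fun l l' h =>
  (hL.isLUB_atomsBelow l).unique (h ▸ hL.isLUB_atomsBelow l')

theorem IsGeometricMeetSemilattice.le_of_atomsBelow_subset (hL : IsGeometricMeetSemilattice L)
    {l l' : L} (h : atomsBelow l ⊆ atomsBelow l') : l ≤ l' :=
  (isLUB_atomSet_iff.1 (hL.isLUB_atomsBelow l) l').2 fun _ ha => mem_atomsBelow.1 (h ha)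

theorem IsGeometricMeetSemilattice.card_greedyBasis (hL : IsGeometricMeetSemilattice L)
    {e : Atoms L → ℕ} (he : Function.Injective e) (l : L) :
    (greedyBasis e l).card = grade ℕ l :=
  (hL.greedySubset_spec he _ (hL.isLUB_atomsBelow l)).1

theorem IsGeometricMeetSemilattice.greedyBasis_injective (hL : IsGeometricMeetSemilattice L)
    {e : Atoms L → ℕ} (he : Function.Injective e) :
    Function.Injective (greedyBasis e : L → Finset (Atoms L)) := fun l l' h =>
  (hL.greedySubset_spec he _ (hL.isLUB_atomsBelow l)).2.unique
    ((show greedySubset e _ = greedySubset e _ from h) ▸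
      (hL.greedySubset_spec he _ (hL.isLUB_atomsBelow l')).2)

/-- This covers the elements below which the atoms are independent, as happens under every
non-square-free monomial. -/
theorem IsGeometricMeetSemilattice.greedyBasis_eq_atomsBelow (hL : IsGeometricMeetSemilattice L)
    {e : Atoms L → ℕ} (he : Function.Injective e) {l : L}
    (h : (atomsBelow l).card ≤ grade ℕ l) : greedyBasis e l = atomsBelow l :=
  Finset.eq_of_subset_of_card_le (greedySubset_subset e _) (by rwa [hL.card_greedyBasis he])

/-- The lexicographically first bases form a simplicial complex. -/
theorem IsGeometricMeetSemilattice.exists_greedyBasis_eq (hL : IsGeometricMeetSemilattice L)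
    {e : Atoms L → ℕ} (he : Function.Injective e) {l : L} {T : Finset (Atoms L)}
    (hT : T ⊆ greedyBasis e l) : ∃ l', greedyBasis e l' = T := by
  have hTl : ∀ a ∈ T, a.1 ≤ l := fun a ha =>
    mem_atomsBelow.1 (greedySubset_subset e _ (hT ha))
  obtain ⟨l', hl'⟩ := hL.exists_isLUB_atomSet hTl
  have hle : l' ≤ l := (isLUB_atomSet_iff.1 hl' l).2 hTl
  -- An atom chosen for l stays chosen for the join l' of T, since fewer atoms precede it.
  -- Conversely the basis of l' has r(l') elements, and r(l') is at most the size of T.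
  refine ⟨l', (Finset.eq_of_subset_of_card_le (fun a ha => ?_) ?_).symm⟩
  · obtain ⟨-, z, hz, haz⟩ := mem_greedySubset.1 (hT ha)
    refine mem_greedySubset.2
      ⟨mem_atomsBelow.2 ((isLUB_atomSet_iff.1 hl' l').1 le_rfl a ha), z, fun c hc => ?_, haz⟩
    exact hz c (mem_atomsBelow.2 ((mem_atomsBelow.1 hc).trans hle))
  · rw [hL.card_greedyBasis he]
    exact hL.grade_le_card T hl'

end GreedyBasis

/-! ### Square-free monomials and division by a variable -/

section SquarefreeMonomial

variable {σ : Type*}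

/-- The product of the variables indexed by `S`. -/
noncomputable def squarefreeMonomial (S : Finset σ) : σ →₀ ℕ :=
  Finsupp.indicator S fun _ _ => 1

open Classical in
theorem squarefreeMonomial_apply (S : Finset σ) (a : σ) :
    squarefreeMonomial S a = if a ∈ S then 1 else 0 := by
  rw [squarefreeMonomial, Finsupp.indicator_apply]
  split_ifs <;> rfl

theorem squarefreeMonomial_le_one (S : Finset σ) (a : σ) : squarefreeMonomial S a ≤ 1 := by
  rw [squarefreeMonomial_apply]
  split_ifs <;> omega

theorem support_squarefreeMonomial (S : Finset σ) : (squarefreeMonomial S).support = S := by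
  ext a
  simp [squarefreeMonomial_apply]

theorem squarefreeMonomial_injective :
    Function.Injective (squarefreeMonomial : Finset σ → σ →₀ ℕ) := fun S T h => by
  rw [← support_squarefreeMonomial S, h, support_squarefreeMonomial]

theorem degree_squarefreeMonomial (S : Finset σ) : (squarefreeMonomial S).degree = S.card := by
  classical
  rw [Finsupp.degree_apply, support_squarefreeMonomial, Finset.card_eq_sum_ones]
  exact Finset.sum_congr rfl fun a ha => by rw [squarefreeMonomial_apply, if_pos ha]

theorem eq_squarefreeMonomial_support {m : σ →₀ ℕ} (hm : ∀ a, m a ≤ 1) :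
    m = squarefreeMonomial m.support := by
  ext a
  rw [squarefreeMonomial_apply]
  have := hm a
  split_ifs with h
  · have := Finsupp.mem_support_iff.1 h
    omega
  · exact Finsupp.notMem_support_iff.1 h

theorem sub_single_add_single {m : σ →₀ ℕ} {b : σ} (hb : m b ≠ 0) :
    m - Finsupp.single b 1 + Finsupp.single b 1 = m :=
  tsub_add_cancel_of_le (Finsupp.single_le_iff.2 (Nat.one_le_iff_ne_zero.2 hb))

theorem degree_sub_single {m : σ →₀ ℕ} {b : σ} (hb : m b ≠ 0) :
    (m - Finsupp.single b 1).degree + 1 = m.degree := by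
  have := congrArg Finsupp.degree (sub_single_add_single hb)
  rwa [map_add, Finsupp.degree_single] at this

theorem sub_single_apply_self (m : σ →₀ ℕ) (b : σ) :
    (m - Finsupp.single b 1 : σ →₀ ℕ) b = m b - 1 := by
  simp

theorem sub_single_apply_of_ne (m : σ →₀ ℕ) {a b : σ} (h : a ≠ b) :
    (m - Finsupp.single b 1 : σ →₀ ℕ) a = m a := by
  simp [Finsupp.single_eq_of_ne h]

theorem support_sub_single_of_two_le {m : σ →₀ ℕ} {b : σ} (hb : 2 ≤ m b) :
    (m - Finsupp.single b 1).support = m.support := by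
  ext a
  rw [Finsupp.mem_support_iff, Finsupp.mem_support_iff]
  by_cases h : a = b
  · subst h
    rw [sub_single_apply_self]
    omega
  · rw [sub_single_apply_of_ne m h]

theorem le_sub_single {p m : σ →₀ ℕ} {b : σ} (h : p ≤ m) (hb : p b < m b) :
    p ≤ m - Finsupp.single b 1 := by
  intro a
  by_cases hab : a = b
  · subst hab
    rw [sub_single_apply_self]
    omega
  · rw [sub_single_apply_of_ne m hab]
    exact h a

theorem exists_lt_of_le_of_ne {p m : σ →₀ ℕ} (h : p ≤ m) (hne : p ≠ m) : ∃ b, p b < m b := by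
  by_contra! hcon
  exact hne (le_antisymm h hcon)

theorem isLowerSet_of_sub_single_mem {I : Set (σ →₀ ℕ)}
    (h : ∀ m ∈ I, ∀ b, m b ≠ 0 → m - Finsupp.single b 1 ∈ I) : IsLowerSet I := by
  have key : ∀ n : ℕ, ∀ m p : σ →₀ ℕ, m.degree = n → p ≤ m → m ∈ I → p ∈ I := by
    intro n
    induction n with
    | zero =>
      intro m p hm hp hmI
      obtain rfl := (Finsupp.degree_eq_zero_iff m).1 hm
      rwa [nonpos_iff_eq_zero.1 hp]
    | succ n ih =>
      intro m p hm hp hmI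
      by_cases hne : p = m
      · rwa [hne]
      · obtain ⟨b, hb⟩ := exists_lt_of_le_of_ne hp hne
        have hd := degree_sub_single (show m b ≠ 0 by omega)
        exact ih _ p (by omega) (le_sub_single hp hb) (h m hmI b (by omega))
  exact fun m p hp hm => key _ m p rfl hp hm

end SquarefreeMonomial

/-! ### Members of the family and their associated multicomplexes -/

section Carrier

variable {L : Type*} [SemilatticeInf L] [OrderBot L]

theorem isAtomMonomial_iff [Finite (Atoms L)] {l : L} {m : Atoms L →₀ ℕ} :
    IsAtomMonomial l m ↔ m = squarefreeMonomial (atomsBelow l) := by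
  classical
  rw [DFunLike.ext_iff]
  refine forall_congr' fun a => ?_
  rw [squarefreeMonomial_apply]
  simp only [mem_atomsBelow]

/-- The closure properties of the sets of monomials in the family: the square-free members are
the monomials `m(l)`, and the other members stay in the set when divided by a variable. -/
structure IsMonomialExtension (C : Set (Atoms L →₀ ℕ)) : Prop where
  squarefree_mem_iff : ∀ m, (∀ a, m a ≤ 1) → (m ∈ C ↔ ∃ l : L, IsAtomMonomial l m)
  sub_single_mem : ∀ m ∈ C, ∀ a, 2 ≤ m a → ∀ b, m b ≠ 0 → m - Finsupp.single b 1 ∈ C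

/-- Dividing by a variable of exponent at least 2 keeps the support, and repeating this ends at some
m(l). -/
theorem IsMonomialExtension.exists_support_eq [Finite (Atoms L)] {C : Set (Atoms L →₀ ℕ)}
    (hC : IsMonomialExtension C) {m : Atoms L →₀ ℕ} (hm : m ∈ C) :
    ∃ l : L, m.support = atomsBelow l := by
  induction hn : m.degree generalizing m with
  | zero =>
    obtain rfl := (Finsupp.degree_eq_zero_iff m).1 hn
    obtain ⟨l, hl⟩ := (hC.squarefree_mem_iff 0 fun a => Nat.zero_le _).1 hm
    exact ⟨l, by rw [isAtomMonomial_iff.1 hl, support_squarefreeMonomial]⟩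
  | succ n ih =>
    by_cases hsq : ∀ a, m a ≤ 1
    · obtain ⟨l, hl⟩ := (hC.squarefree_mem_iff m hsq).1 hm
      exact ⟨l, by rw [isAtomMonomial_iff.1 hl, support_squarefreeMonomial]⟩
    · push Not at hsq
      obtain ⟨a, ha⟩ := hsq
      have hd := degree_sub_single (show m a ≠ 0 by omega)
      have h := ih (hC.sub_single_mem m hm a ha a (by omega)) (by omega)
      rwa [support_sub_single_of_two_le ha] at h

variable [GradeMinOrder ℕ L]

/-- While x_a² divides m, every other variable may be divided out without leaving C, and each
support met on the way is the set of atoms below some element. Each time an atom disappears, that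
element drops strictly, and so does its rank. The descent ends with the support {a}, of rank at
least 1. -/
theorem IsMonomialExtension.card_atomsBelow_le_grade [Finite (Atoms L)]
    (hL : IsGeometricMeetSemilattice L) {C : Set (Atoms L →₀ ℕ)} (hC : IsMonomialExtension C)
    {m : Atoms L →₀ ℕ} (hm : m ∈ C) {a : Atoms L} (ha : 2 ≤ m a) {l : L}
    (hl : m.support = atomsBelow l) : (atomsBelow l).card ≤ grade ℕ l := by
  classical
  induction hn : m.degree using Nat.strong_induction_on generalizing m l with
  | _ n ih =>
    have hal : a ∈ atomsBelow l := by
      rw [← hl, Finsupp.mem_support_iff]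
      omega
    by_cases h : ∃ b, b ≠ a ∧ m b ≠ 0
    · obtain ⟨b, hba, hb⟩ := h
      have hd := degree_sub_single hb
      have hmem := hC.sub_single_mem m hm a ha b hb
      have ha' : 2 ≤ (m - Finsupp.single b 1 : Atoms L →₀ ℕ) a := by
        rwa [sub_single_apply_of_ne m hba.symm]
      by_cases hb2 : 2 ≤ m b
      · exact ih _ (by omega) hmem ha' ((support_sub_single_of_two_le hb2).trans hl) rfl
      · obtain ⟨l', hl'⟩ := hC.exists_support_eq hmem
        have hlb : b ∈ atomsBelow l := hl ▸ Finsupp.mem_support_iff.2 hb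
        have hE : atomsBelow l' = (atomsBelow l).erase b := by
          rw [← hl, ← hl']
          ext c
          rw [Finset.mem_erase, Finsupp.mem_support_iff, Finsupp.mem_support_iff]
          by_cases hc : c = b
          · subst hc
            rw [sub_single_apply_self]
            simp only [ne_eq, not_true_eq_false, false_and, iff_false, not_not]
            omega
          · rw [sub_single_apply_of_ne m hc]
            simp [hc]
        have h1 := ih _ (by omega) hmem ha' hl' rfl
        have hle : l' ≤ l := hL.le_of_atomsBelow_subset (hE ▸ Finset.erase_subset _ _)
        have hlt : l' < l := lt_of_le_of_ne hle fun h => by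
          rw [h] at hE
          exact Finset.notMem_erase b _ (hE ▸ hlb)
        have h2 : grade ℕ l' < grade ℕ l := grade_strictMono hlt
        rw [hE, Finset.card_erase_of_mem hlb] at h1
        omega
    · have h1 : (atomsBelow l).card ≤ 1 := by
        refine (Finset.card_le_card fun b hb => ?_).trans (Finset.card_singleton a).le
        rw [← hl, Finsupp.mem_support_iff] at hb
        by_contra hne
        exact h ⟨b, by simpa using hne, hb⟩
      have h2 : grade ℕ a.1 ≤ grade ℕ l := grade_mono (mem_atomsBelow.1 hal)
      rw [a.2.grade_nat] at h2
      omega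

theorem card_atomsBelow_ge_grade [Finite (Atoms L)] (hL : IsGeometricMeetSemilattice L) (l : L) :
    grade ℕ l ≤ (atomsBelow l).card :=
  hL.grade_le_card _ (hL.isLUB_atomsBelow l)

/-- The multicomplex with the same numbers of elements in each rank as `C`. -/
def basisMulticomplex [Finite (Atoms L)] (e : Atoms L → ℕ) (C : Set (Atoms L →₀ ℕ)) :
    Set (Atoms L →₀ ℕ) :=
  Set.range (fun l : L => squarefreeMonomial (greedyBasis e l)) ∪ {m | m ∈ C ∧ ∃ a, 2 ≤ m a}

/-- Within each of the two parts, closure is known. The point is the passage from a non-square-free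
m to a square-free m(l): there the atoms below l are independent, so m(l) is itself the product over
the greedy basis. -/
theorem IsMonomialExtension.isLowerSet_basisMulticomplex [Finite (Atoms L)]
    (hL : IsGeometricMeetSemilattice L) {e : Atoms L → ℕ} (he : Function.Injective e)
    {C : Set (Atoms L →₀ ℕ)} (hC : IsMonomialExtension C) :
    IsLowerSet (basisMulticomplex e C) := by
  classical
  refine isLowerSet_of_sub_single_mem ?_
  rintro m (⟨l, rfl⟩ | ⟨hm, a, ha⟩) b hb
  · left
    have h1 : ∀ c, (squarefreeMonomial (greedyBasis e l) - Finsupp.single b 1 : Atoms L →₀ ℕ) c ≤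
        squarefreeMonomial (greedyBasis e l) c := fun c => by
      rw [Finsupp.tsub_apply]
      exact Nat.sub_le _ _
    have h2 := eq_squarefreeMonomial_support fun c =>
      (h1 c).trans (squarefreeMonomial_le_one _ c)
    have h3 := Finsupp.support_mono (show _ ≤ _ from h1)
    rw [support_squarefreeMonomial] at h3
    obtain ⟨l', hl'⟩ := hL.exists_greedyBasis_eq he h3
    exact ⟨l', by change squarefreeMonomial _ = _; rw [hl', ← h2]⟩
  · have hmem := hC.sub_single_mem m hm a ha b hb
    by_cases hsq : ∀ c, (m - Finsupp.single b 1 : Atoms L →₀ ℕ) c ≤ 1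
    · left
      obtain ⟨l, hl⟩ := (hC.squarefree_mem_iff _ hsq).1 hmem
      rw [isAtomMonomial_iff] at hl
      have hab : a = b := by
        by_contra hab
        have := hsq a
        rw [sub_single_apply_of_ne m hab] at this
        omega
      subst hab
      have hs : m.support = atomsBelow l := by
        rw [← support_sub_single_of_two_le ha, hl, support_squarefreeMonomial]
      refine ⟨l, ?_⟩
      change squarefreeMonomial _ = _
      rw [hl, hL.greedyBasis_eq_atomsBelow he (hC.card_atomsBelow_le_grade hL hm ha hs)]
    · push Not at hsq
      exact Or.inr ⟨hmem, hsq⟩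

/-- The rank function of the members of the family. -/
structure IsMonomialRank (C : Set (Atoms L →₀ ℕ)) (r : (Atoms L →₀ ℕ) → ℕ) : Prop where
  atomMonomial : ∀ (l : L) m, IsAtomMonomial l m → r m = grade ℕ l
  eq_degree : ∀ m ∈ C, ∀ a, 2 ≤ m a → r m = m.degree

/-- The non-square-free parts coincide, with rank equal to degree. Both square-free parts are
indexed injectively by L, and l sits in level r(l) in each. -/
theorem ncard_level_eq_of_isMonomialExtension [Finite (Atoms L)]
    (hL : IsGeometricMeetSemilattice L) {e : Atoms L → ℕ} (he : Function.Injective e)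
    {C : Set (Atoms L →₀ ℕ)} (hC : IsMonomialExtension C) {r : (Atoms L →₀ ℕ) → ℕ}
    (hr : IsMonomialRank C r) (j : ℕ) :
    {m | m ∈ C ∧ r m = j}.Finite ∧
      {m | m ∈ C ∧ r m = j}.ncard = (degreeLevel (basisMulticomplex e C) j).ncard := by
  have hN : (degreeLevel {m | m ∈ C ∧ ∃ a, 2 ≤ m a} j).Finite := finite_degreeLevel_of_finite _ _
  have hG : {l : L | grade ℕ l = j}.Finite := hL.finite_rank j
  have hi1 : Function.Injective fun l : L => squarefreeMonomial (atomsBelow l) :=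
    squarefreeMonomial_injective.comp hL.atomsBelow_injective
  have hi2 : Function.Injective fun l : L => squarefreeMonomial (greedyBasis e l) :=
    squarefreeMonomial_injective.comp (hL.greedyBasis_injective he)
  have hdisj : ∀ f : L → Finset (Atoms L), Disjoint
      ((fun l : L => squarefreeMonomial (f l)) '' {l : L | grade ℕ l = j})
      (degreeLevel {m | m ∈ C ∧ ∃ a, 2 ≤ m a} j) := by
    intro f
    rw [Set.disjoint_left]
    rintro _ ⟨l, -, rfl⟩ ⟨⟨-, a, ha⟩, -⟩
    exact absurd (squarefreeMonomial_le_one (f l) a) (not_le.2 ha)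
  have h1 : {m | m ∈ C ∧ r m = j} =
      (fun l : L => squarefreeMonomial (atomsBelow l)) '' {l : L | grade ℕ l = j} ∪
        degreeLevel {m | m ∈ C ∧ ∃ a, 2 ≤ m a} j := by
    ext m
    constructor
    · rintro ⟨hm, hj⟩
      by_cases hsq : ∀ a, m a ≤ 1
      · obtain ⟨l, hl⟩ := (hC.squarefree_mem_iff m hsq).1 hm
        exact Or.inl ⟨l, (hr.atomMonomial l m hl).symm.trans hj, (isAtomMonomial_iff.1 hl).symm⟩
      · push Not at hsq
        obtain ⟨a, ha⟩ := hsq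
        exact Or.inr ⟨⟨hm, a, ha⟩, (hr.eq_degree m hm a ha).symm.trans hj⟩
    · rintro (⟨l, hl, rfl⟩ | ⟨⟨hm, a, ha⟩, hj⟩)
      · have h := isAtomMonomial_iff.2 (Eq.refl (squarefreeMonomial (atomsBelow l)))
        exact ⟨(hC.squarefree_mem_iff _ (squarefreeMonomial_le_one _)).2 ⟨l, h⟩,
          (hr.atomMonomial l _ h).trans hl⟩
      · exact ⟨hm, (hr.eq_degree m hm a ha).trans hj⟩
  have h2 : degreeLevel (basisMulticomplex e C) j =
      (fun l : L => squarefreeMonomial (greedyBasis e l)) '' {l : L | grade ℕ l = j} ∪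
        degreeLevel {m | m ∈ C ∧ ∃ a, 2 ≤ m a} j := by
    have hd (l : L) : (squarefreeMonomial (greedyBasis e l)).degree = grade ℕ l := by
      rw [degree_squarefreeMonomial, hL.card_greedyBasis he]
    ext m
    constructor
    · rintro ⟨⟨l, rfl⟩ | hm, hj⟩
      · exact Or.inl ⟨l, (hd l).symm.trans hj, rfl⟩
      · exact Or.inr ⟨hm, hj⟩
    · rintro (⟨l, hl, rfl⟩ | ⟨hm, hj⟩)
      · exact ⟨Or.inl ⟨l, rfl⟩, (hd l).trans hl⟩
      · exact ⟨Or.inr hm, hj⟩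
  rw [h1, h2, Set.ncard_union_eq (hdisj _) (hG.image _) hN,
    Set.ncard_union_eq (hdisj _) (hG.image _) hN, Set.ncard_image_of_injective _ hi1,
    Set.ncard_image_of_injective _ hi2]
  exact ⟨(hG.image _).union hN, rfl⟩

theorem MonomialPoset.macaulayInequalities_of_isMonomialExtension
    (hL : IsGeometricMeetSemilattice L) {P : MonomialPoset (Atoms L)}
    (hC : IsMonomialExtension P.carrier) (hr : IsMonomialRank P.carrier P.rank) :
    (∀ j, (P.level j).Finite) ∧ P.levelCard 0 = 1 ∧ P.MacaulayInequalities := by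
  have := hL.finite_atoms
  obtain ⟨e, he⟩ := Countable.exists_injective_nat (Atoms L)
  have hlev := ncard_level_eq_of_isMonomialExtension hL he hC hr
  have hlow := hC.isLowerSet_basisMulticomplex hL he
  have hcard : ∀ j, P.levelCard j = (degreeLevel (basisMulticomplex e P.carrier) j).ncard :=
    fun j => (hlev j).2
  refine ⟨fun j => (hlev j).1, ?_, fun k => ⟨Nat.zero_le _, ?_⟩⟩
  · rw [hcard, Set.ncard_eq_one]
    refine ⟨0, ?_⟩
    ext m
    constructor
    · rintro ⟨-, hm⟩
      exact (Finsupp.degree_eq_zero_iff m).1 hm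
    · rintro rfl
      exact ⟨hlow bot_le (Or.inl ⟨⊥, rfl⟩), map_zero _⟩
  · rw [hcard, hcard]
    exact macaulayPartial_degreeLevel_le k _ hlow

theorem IsInitial.isMonomialExtension {M : MonomialPoset (Atoms L)} (hM : IsInitial M) :
    IsMonomialExtension M.carrier ∧ IsMonomialRank M.carrier M.rank := by
  have h : ∀ m ∈ M.carrier, ∀ a, ¬ 2 ≤ m a := by
    intro m hm a ha
    obtain ⟨l, hl⟩ := (hM.mem_carrier_iff m).1 hm
    have := hl a
    split_ifs at this <;> omega
  exact ⟨⟨fun m _ => hM.mem_carrier_iff m, fun m hm a ha => absurd ha (h m hm a)⟩,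
    ⟨hM.rank_eq, fun m hm a ha => absurd ha (h m hm a)⟩⟩

/-- The new monomial is divisible by x_a², and its quotients by a variable are the exchanged
monomials, which are already present. Only its rank needs an argument. -/
theorem MonomialPoset.CanAdjoin.isMonomialExtension (hL : IsGeometricMeetSemilattice L)
    {M : MonomialPoset (Atoms L)} {m : Atoms L →₀ ℕ} {a : Atoms L} (h : M.CanAdjoin m a)
    (hC : IsMonomialExtension M.carrier) (hr : IsMonomialRank M.carrier M.rank) :
    IsMonomialExtension (M.adjoin m a).carrier ∧
      IsMonomialRank (M.adjoin m a).carrier (M.adjoin m a).rank := by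
  have := hL.finite_atoms
  have hma := h.dvd
  have h2 : 2 ≤ (m + Finsupp.single a 1 : Atoms L →₀ ℕ) a := by
    rw [Finsupp.add_apply, Finsupp.single_eq_same]
    omega
  have hC' : IsMonomialExtension (M.adjoin m a).carrier := by
    constructor
    · intro p hp
      rw [← hC.squarefree_mem_iff p hp]
      refine ⟨fun h' => h'.resolve_left ?_, Or.inr⟩
      rintro rfl
      have := hp a
      omega
    · rintro p (rfl | hp) c hc b hb
      · refine Or.inr (h.exchange_mem b fun hmb => hb ?_)
        have hab : b ≠ a := fun h' => hma (h' ▸ hmb)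
        rw [Finsupp.add_apply, hmb, Finsupp.single_eq_of_ne hab, add_zero]
      · exact Or.inr (hC.sub_single_mem p hp c hc b hb)
  have hne : ∀ p ∈ M.carrier, (M.adjoin m a).rank p = M.rank p := by
    intro p hp
    have hpm : p ≠ m + Finsupp.single a 1 := by
      rintro rfl
      exact h.notMem hp
    simp [MonomialPoset.adjoin, hpm]
  refine ⟨hC', ⟨fun l p hp => ?_, ?_⟩⟩
  · have hpC : p ∈ M.carrier := by
      refine (hC.squarefree_mem_iff p fun b => ?_).2 ⟨l, hp⟩
      rw [isAtomMonomial_iff.1 hp]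
      exact squarefreeMonomial_le_one _ b
    rw [hne p hpC, hr.atomMonomial l p hp]
  · rintro p (rfl | hp) c hc
    · have hrank : (M.adjoin m a).rank (m + Finsupp.single a 1) = M.rank m + 1 := by
        simp only [MonomialPoset.adjoin, Function.update_self]
      rw [hrank, map_add, Finsupp.degree_single]
      congr 1
      by_cases hsq : ∀ b, m b ≤ 1
      · obtain ⟨l, hl⟩ := (hC.squarefree_mem_iff m hsq).1 h.mem
        have hm := isAtomMonomial_iff.1 hl
        have hsupp : (m + Finsupp.single a 1).support = atomsBelow l := by
          rw [← support_sub_single_of_two_le h2, add_tsub_cancel_right, hm,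
            support_squarefreeMonomial]
        -- Applied in the enlarged set to x_a m, which has the support of m = m(l): the mere
        -- possibility of adjoining it shows that r(l) is the degree of m(l).
        have h3 := hC'.card_atomsBelow_le_grade hL (Or.inl rfl) h2 hsupp
        have h4 := card_atomsBelow_ge_grade hL l
        rw [hr.atomMonomial l m hl, hm, degree_squarefreeMonomial]
        omega
      · push Not at hsq
        obtain ⟨b, hb⟩ := hsq
        exact hr.eq_degree m h.mem b hb
    · rw [hne p hp]
      exact hr.eq_degree p hp c hc

theorem InFamily.isMonomialExtension (hL : IsGeometricMeetSemilattice L)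
    {P : MonomialPoset (Atoms L)} (hP : InFamily L P) :
    IsMonomialExtension P.carrier ∧ IsMonomialRank P.carrier P.rank := by
  have := hL.finite_atoms
  obtain ⟨M, h0, hstep, hU⟩ := hP
  have key : ∀ i, IsMonomialExtension (M i).carrier ∧
      IsMonomialRank (M i).carrier (M i).rank := by
    intro i
    induction i with
    | zero => exact h0.isMonomialExtension
    | succ i ih =>
      rcases hstep i with h | ⟨m, a, h, he⟩
      · rwa [h]
      · rw [he]
        exact h.isMonomialExtension hL ih.1 ih.2
  have hmem : ∀ p, p ∈ P.carrier ↔ ∃ i, p ∈ (M i).carrier := fun p => by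
    rw [hU.carrier_eq, Set.mem_iUnion]
  refine ⟨⟨fun p hp => ?_, fun p hp a ha b hb => ?_⟩, ⟨fun l p hp => ?_, fun p hp a ha => ?_⟩⟩
  · rw [hmem]
    refine ⟨fun ⟨i, hi⟩ => ((key i).1.squarefree_mem_iff p hp).1 hi, fun h => ⟨0, ?_⟩⟩
    exact ((key 0).1.squarefree_mem_iff p hp).2 h
  · obtain ⟨i, hi⟩ := (hmem p).1 hp
    exact (hmem _).2 ⟨i, (key i).1.sub_single_mem p hi a ha b hb⟩
  · have hp0 : p ∈ (M 0).carrier := (h0.mem_carrier_iff p).2 ⟨l, hp⟩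
    rw [hU.rank_eq 0 p hp0, h0.rank_eq l p hp]
  · obtain ⟨i, hi⟩ := (hmem p).1 hp
    rw [hU.rank_eq i p hi, (key i).2.eq_degree p hi a ha]

end Carrier

/-! ### The semi-lattice itself as a member of the family -/

section InitialMember

variable {L : Type u} [SemilatticeInf L] [OrderBot L] [GradeMinOrder ℕ L]

open Classical in
variable (L) in
/-- The collection of all monomials `m(l)` with the rank and the order of `L`. -/
noncomputable def initialPoset : MonomialPoset (Atoms L) where
  carrier := {m | ∃ l : L, IsAtomMonomial l m}
  rank m := if h : ∃ l : L, IsAtomMonomial l m then grade ℕ h.choose else 0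
  le p q := ∃ l l' : L, IsAtomMonomial l p ∧ IsAtomMonomial l' q ∧ l ≤ l'

theorem IsAtomMonomial.unique (hL : IsGeometricMeetSemilattice L) {l l' : L}
    {m : Atoms L →₀ ℕ} (h : IsAtomMonomial l m) (h' : IsAtomMonomial l' m) : l = l' := by
  have := hL.finite_atoms
  exact hL.atomsBelow_injective
    (squarefreeMonomial_injective ((isAtomMonomial_iff.1 h).symm.trans (isAtomMonomial_iff.1 h')))

theorem isInitial_initialPoset (hL : IsGeometricMeetSemilattice L) :
    IsInitial (initialPoset L) := by
  refine ⟨fun m => Iff.rfl, fun l m h => ?_, fun p q => Iff.rfl⟩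
  have hex : ∃ l : L, IsAtomMonomial l m := ⟨l, h⟩
  simp only [initialPoset, dif_pos hex]
  rw [hex.choose_spec.unique hL h]

theorem MonomialPoset.isUnion_const {σ : Type*} (P : MonomialPoset σ) :
    MonomialPoset.IsUnion (fun _ => P) P :=
  ⟨(Set.iUnion_const _).symm, fun _ _ _ => rfl, fun _ _ => (exists_const ℕ).symm⟩

theorem IsGeometricMeetSemilattice.exists_inFamily_isoTo (hL : IsGeometricMeetSemilattice L) :
    ∃ P : MonomialPoset (Atoms L), InFamily L P ∧ P.IsoTo L (grade ℕ) := by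
  have := hL.finite_atoms
  have hI := isInitial_initialPoset hL
  refine ⟨initialPoset L, ⟨fun _ => initialPoset L, hI, fun _ => Or.inl rfl,
    MonomialPoset.isUnion_const _⟩, ?_⟩
  have hm (l : L) : IsAtomMonomial l (squarefreeMonomial (atomsBelow l)) :=
    isAtomMonomial_iff.2 rfl
  refine ⟨Equiv.ofBijective (fun l => ⟨squarefreeMonomial (atomsBelow l), l, hm l⟩)
    ⟨fun l l' h => ?_, fun ⟨m, l, h⟩ => ⟨l, Subtype.ext (isAtomMonomial_iff.1 h).symm⟩⟩, ?_, ?_⟩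
  · exact hL.atomsBelow_injective (squarefreeMonomial_injective (congrArg Subtype.val h))
  · intro l l'
    rw [hI.le_iff]
    refine ⟨fun h => ⟨l, l', hm l, hm l', h⟩, ?_⟩
    rintro ⟨k, k', h1, h2, h⟩
    rwa [(hm l).unique hL h1, (hm l').unique hL h2]
  · exact fun l => hI.rank_eq l _ (hm l)

end InitialMember

/-! ### Building a divisor-closed set of monomials by adjunctions -/

namespace MonomialPoset

variable {σ : Type*}

/-- A set of monomials ordered by divisibility and ranked by degree. -/
noncomputable def divisibilityPoset (J : Set (σ →₀ ℕ)) : MonomialPoset σ where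
  carrier := J
  rank := Finsupp.degree
  le p q := p ∈ J ∧ q ∈ J ∧ p ≤ q

/-- A proper divisor of x_a m divides some x_a m / x_b, and here x_b divides m because x_a already
does. So the prescribed covers generate exactly the divisibility order. -/
theorem divisibilityPoset_adjoin {J : Set (σ →₀ ℕ)} (hJ : IsLowerSet J) {m : σ →₀ ℕ} {a : σ}
    (h : (divisibilityPoset J).CanAdjoin m a) :
    (divisibilityPoset J).adjoin m a = divisibilityPoset (insert (m + Finsupp.single a 1) J) := by
  unfold adjoin
  rw [divisibilityPoset, divisibilityPoset, MonomialPoset.mk.injEq]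
  refine ⟨rfl, ?_, ?_⟩
  · have h' : (m + Finsupp.single a 1).degree = m.degree + 1 := by
      rw [map_add, Finsupp.degree_single]
    funext p
    by_cases hp : p = m + Finsupp.single a 1
    · subst hp
      simp only [Function.update_self, h']
    · simp only [ne_eq, hp, not_false_eq_true, Function.update_of_ne]
  · have hnot : ∀ q ∈ J, ¬ m + Finsupp.single a 1 ≤ q := fun q hq hle =>
      h.notMem (hJ hle hq)
    funext p q
    refine propext ⟨?_, ?_⟩
    · rintro (⟨hp, hq, hle⟩ | ⟨rfl, rfl | ⟨b, hb, hp, -, hle⟩⟩)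
      · exact ⟨Or.inr hp, Or.inr hq, hle⟩
      · exact ⟨Or.inl rfl, Or.inl rfl, le_rfl⟩
      · exact ⟨Or.inr hp, Or.inl rfl, hle.trans tsub_le_self⟩
    · rintro ⟨hp, rfl | hq, hle⟩
      · refine Or.inr ⟨rfl, or_iff_not_imp_left.2 fun hne => ?_⟩
        obtain ⟨b, hb⟩ := exists_lt_of_le_of_ne hle hne
        have hmb : m b ≠ 0 := by
          intro h0
          by_cases hab : b = a
          · exact h.dvd (hab ▸ h0)
          · rw [Finsupp.add_apply, h0, Finsupp.single_eq_of_ne hab] at hb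
            omega
        exact ⟨b, hmb, hp.resolve_left hne, h.exchange_mem b hmb, le_sub_single hle hb⟩
      · rcases hp with rfl | hp
        · exact absurd hle (hnot q hq)
        · exact Or.inl ⟨hp, hq, hle⟩

/-- An exhaustion of `J` by lower sets starting with its square-free elements: at stage `n` the
monomial `e n` is added, if it lies in `J` and all its proper divisors are present. -/
def exhaustion (J : Set (σ →₀ ℕ)) (e : ℕ → σ →₀ ℕ) : ℕ → Set (σ →₀ ℕ)
  | 0 => {m | m ∈ J ∧ ∀ a, m a ≤ 1}
  | n + 1 => exhaustion J e n ∪ {m | m = e n ∧ m ∈ J ∧ (∃ a, 2 ≤ m a) ∧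
      ∀ b, m b ≠ 0 → m - Finsupp.single b 1 ∈ exhaustion J e n}

theorem exhaustion_mono (J : Set (σ →₀ ℕ)) (e : ℕ → σ →₀ ℕ) : Monotone (exhaustion J e) :=
  monotone_nat_of_le_succ fun _ => Set.subset_union_left

theorem exhaustion_subset (J : Set (σ →₀ ℕ)) (e : ℕ → σ →₀ ℕ) (n : ℕ) :
    exhaustion J e n ⊆ J := by
  induction n with
  | zero => exact fun m hm => hm.1
  | succ n ih => exact Set.union_subset ih fun m hm => hm.2.1

theorem isLowerSet_exhaustion {J : Set (σ →₀ ℕ)} (hJ : IsLowerSet J) (e : ℕ → σ →₀ ℕ) (n : ℕ) :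
    IsLowerSet (exhaustion J e n) := by
  induction n with
  | zero => exact fun m p h hm => ⟨hJ h hm.1, fun a => (h a).trans (hm.2 a)⟩
  | succ n ih =>
    refine isLowerSet_of_sub_single_mem ?_
    rintro m (hm | ⟨-, -, -, hm⟩) b hb
    · exact Or.inl (ih tsub_le_self hm)
    · exact Or.inl (hm b hb)

theorem exhaustion_step {J : Set (σ →₀ ℕ)} (hJ : IsLowerSet J) (e : ℕ → σ →₀ ℕ) (n : ℕ) :
    divisibilityPoset (exhaustion J e (n + 1)) = divisibilityPoset (exhaustion J e n) ∨
      ∃ m a, (divisibilityPoset (exhaustion J e n)).CanAdjoin m a ∧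
        divisibilityPoset (exhaustion J e (n + 1)) =
          (divisibilityPoset (exhaustion J e n)).adjoin m a := by
  by_cases h : (e n ∈ J ∧ (∃ a, 2 ≤ e n a) ∧
      ∀ b, e n b ≠ 0 → e n - Finsupp.single b 1 ∈ exhaustion J e n) ∧ e n ∉ exhaustion J e n
  · obtain ⟨⟨h1, ⟨a, ha⟩, h2⟩, h3⟩ := h
    have ha0 : e n a ≠ 0 := by omega
    have hadd := sub_single_add_single ha0
    -- The variable to adjoin must have exponent at least 2 in `e n`, so that it still divides the
    -- quotient.
    have hcan : (divisibilityPoset (exhaustion J e n)).CanAdjoin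
        (e n - Finsupp.single a 1) a := by
      refine ⟨h2 a ha0, ?_, fun b hb => ?_, ?_⟩
      · rw [sub_single_apply_self]
        omega
      · rw [exchange, hadd]
        refine h2 b fun hb0 => hb ?_
        rw [Finsupp.tsub_apply, hb0, Nat.zero_sub]
      · rwa [hadd]
    refine Or.inr ⟨_, a, hcan, ?_⟩
    rw [divisibilityPoset_adjoin (isLowerSet_exhaustion hJ e n) hcan, hadd]
    congr 1
    ext m
    constructor
    · rintro (hm | ⟨rfl, -⟩)
      · exact Or.inr hm
      · exact Or.inl rfl
    · rintro (rfl | hm)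
      · exact Or.inr ⟨rfl, h1, ⟨a, ha⟩, h2⟩
      · exact Or.inl hm
  · left
    congr 1
    refine Set.union_eq_left.2 ?_
    rintro m ⟨rfl, hm⟩
    by_contra hmem
    exact h ⟨hm, hmem⟩

/-- By induction on the degree, all quotients m / x_b are present from some common stage on. Since e
takes the value m again after that stage, m is then added. -/
theorem exists_mem_exhaustion {J : Set (σ →₀ ℕ)} (hJ : IsLowerSet J) {e : ℕ → σ →₀ ℕ}
    (he : ∀ m N, ∃ n, N ≤ n ∧ e n = m) {m : σ →₀ ℕ} (hm : m ∈ J) :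
    ∃ n, m ∈ exhaustion J e n := by
  induction hd : m.degree using Nat.strong_induction_on generalizing m with
  | _ d ih =>
    by_cases hsq : ∀ a, m a ≤ 1
    · exact ⟨0, hm, hsq⟩
    · push Not at hsq
      have hex : ∀ b, ∃ n, m b ≠ 0 → m - Finsupp.single b 1 ∈ exhaustion J e n := by
        intro b
        by_cases hb : m b = 0
        · exact ⟨0, fun h => absurd hb h⟩
        · have := degree_sub_single hb
          obtain ⟨n, hn⟩ := ih _ (by omega) (hJ (tsub_le_self (b := Finsupp.single b 1)) hm) rfl
          exact ⟨n, fun _ => hn⟩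
      choose f hf using hex
      obtain ⟨n, hn, rfl⟩ := he m (m.support.sup f)
      refine ⟨n + 1, Or.inr ⟨rfl, hm, hsq, fun b hb => ?_⟩⟩
      exact exhaustion_mono J e
        ((Finset.le_sup (f := f) (Finsupp.mem_support_iff.2 hb)).trans hn) (hf b hb)

theorem isUnion_exhaustion {J : Set (σ →₀ ℕ)} (hJ : IsLowerSet J) {e : ℕ → σ →₀ ℕ}
    (he : ∀ m N, ∃ n, N ≤ n ∧ e n = m) :
    IsUnion (fun n => divisibilityPoset (exhaustion J e n)) (divisibilityPoset J) := by
  refine ⟨?_, fun _ _ _ => rfl, fun p q => ⟨?_, ?_⟩⟩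
  · refine Set.Subset.antisymm (fun m hm => ?_) (Set.iUnion_subset (exhaustion_subset J e))
    exact Set.mem_iUnion.2 (exists_mem_exhaustion hJ he hm)
  · rintro ⟨hp, hq, hle⟩
    obtain ⟨n, hn⟩ := exists_mem_exhaustion hJ he hq
    exact ⟨n, isLowerSet_exhaustion hJ e n hle hn, hn, hle⟩
  · rintro ⟨n, hp, hq, hle⟩
    exact ⟨exhaustion_subset J e n hp, exhaustion_subset J e n hq, hle⟩

theorem exists_enumeration_infinitely_often (α : Type*) [Countable α] [Nonempty α] :
    ∃ e : ℕ → α, ∀ m N, ∃ n, N ≤ n ∧ e n = m := by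
  obtain ⟨f, hf⟩ := exists_surjective_nat α
  refine ⟨fun n => f n.unpair.1, fun m N => ?_⟩
  obtain ⟨k, rfl⟩ := hf m
  exact ⟨Nat.pair k N, Nat.right_le_pair k N, by simp⟩

end MonomialPoset

/-! ### Multicomplexes and their face posets -/

section Multicomplex

/-- A non-empty set of monomials containing all divisors of its elements. -/
structure Multicomplex (σ : Type u) where
  carrier : Set (σ →₀ ℕ)
  isLowerSet : IsLowerSet carrier
  nonempty : carrier.Nonempty

variable {σ : Type u}

/-- The supports of the square-free elements of a multicomplex. -/
def Multicomplex.Face (K : Multicomplex σ) : Type u :=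
  {s : Finset σ // squarefreeMonomial s ∈ K.carrier}

namespace Multicomplex

variable {K : Multicomplex σ}

theorem zero_mem (K : Multicomplex σ) : (0 : σ →₀ ℕ) ∈ K.carrier :=
  K.nonempty.elim fun _ hm => K.isLowerSet bot_le hm

theorem squarefreeMonomial_mem_of_subset {s t : Finset σ} (hst : s ⊆ t)
    (ht : squarefreeMonomial t ∈ K.carrier) : squarefreeMonomial s ∈ K.carrier := by
  classical
  refine K.isLowerSet (fun a => ?_) ht
  rw [squarefreeMonomial_apply, squarefreeMonomial_apply]
  by_cases h : a ∈ s
  · rw [if_pos h, if_pos (hst h)]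
  · rw [if_neg h]
    exact Nat.zero_le _

instance : PartialOrder K.Face := inferInstanceAs (PartialOrder {s : Finset σ // squarefreeMonomial s ∈ K.carrier})

theorem Face.le_iff {s t : K.Face} : s ≤ t ↔ s.1 ⊆ t.1 := Iff.rfl

open Classical in
noncomputable instance : SemilatticeInf K.Face where
  inf s t := ⟨s.1 ∩ t.1, squarefreeMonomial_mem_of_subset Finset.inter_subset_left s.2⟩
  inf_le_left _ _ := Finset.inter_subset_left
  inf_le_right _ _ := Finset.inter_subset_right
  le_inf _ _ _ h h' := Finset.subset_inter h h'

instance : OrderBot K.Face where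
  bot := ⟨∅, by
    have h : squarefreeMonomial (∅ : Finset σ) = 0 := by
      rw [← Finsupp.support_eq_empty, support_squarefreeMonomial]
    exact h ▸ K.zero_mem⟩
  bot_le s := Finset.empty_subset s.1

theorem Face.exists_covBy_insert [DecidableEq σ] {s t : K.Face} (h : s ⋖ t) :
    ∃ a, a ∉ s.1 ∧ t.1 = insert a s.1 := by
  obtain ⟨a, hat, has⟩ := Finset.exists_of_ssubset (show s.1 ⊂ t.1 from h.lt)
  have hsub : insert a s.1 ⊆ t.1 := Finset.insert_subset hat h.le
  refine ⟨a, has, ?_⟩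
  let w : K.Face := ⟨insert a s.1, squarefreeMonomial_mem_of_subset hsub t.2⟩
  have hsw : s < w := Finset.ssubset_insert has
  have hwt : w ≤ t := hsub
  exact congrArg Subtype.val (hwt.eq_of_not_lt (h.2 hsw)).symm

instance : GradeMinOrder ℕ K.Face where
  grade s := s.1.card
  grade_strictMono _ _ h := Finset.card_strictMono h
  covBy_grade s t h := by
    classical
    obtain ⟨a, ha, hat⟩ := Face.exists_covBy_insert h
    rw [Nat.covBy_iff_add_one_eq, hat, Finset.card_insert_of_notMem ha]
  isMin_grade s h := by
    have hs : s = ⊥ := h.eq_bot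
    subst hs
    exact isMin_bot

theorem Face.grade_eq (s : K.Face) : grade ℕ s = s.1.card := rfl

theorem Face.isAtom_iff {s : K.Face} : IsAtom s ↔ ∃ a, s.1 = {a} := by
  classical
  rw [← bot_covBy_iff]
  constructor
  · intro h
    obtain ⟨a, -, ha⟩ := Face.exists_covBy_insert h
    exact ⟨a, ha.trans (insert_empty_eq a)⟩
  · rintro ⟨a, ha⟩
    refine ⟨?_, fun t h1 h2 => ?_⟩
    · rw [bot_lt_iff_ne_bot]
      rintro rfl
      exact Finset.singleton_ne_empty a ha.symm
    · have h3 : (⊥ : K.Face).1.card < t.1.card := Finset.card_strictMono h1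
      have h4 : t.1.card < s.1.card := Finset.card_strictMono h2
      rw [ha, Finset.card_singleton] at h4
      omega

/-- The atom of the face poset given by an element of a face. -/
def Face.atom (s : K.Face) {a : σ} (ha : a ∈ s.1) : Atoms K.Face :=
  ⟨⟨{a}, squarefreeMonomial_mem_of_subset (Finset.singleton_subset_iff.2 ha) s.2⟩,
    Face.isAtom_iff.2 ⟨a, rfl⟩⟩

/-- A join of two faces, if it exists, is their union: the union lies in the join and is therefore a
face. The rank inequality is then the count of union and intersection. -/
theorem Face.isGeometricMeetSemilattice [Finite σ] (K : Multicomplex σ) :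
    IsGeometricMeetSemilattice K.Face := by
  classical
  have : Finite K.Face := inferInstanceAs (Finite {s : Finset σ // squarefreeMonomial s ∈ K.carrier})
  refine ⟨fun n => Set.toFinite _, ⟨fun s => ?_⟩, fun x y z hz => ?_⟩
  · refine ⟨{t | t ≤ s ∧ IsAtom t}, ⟨fun t ht => ht.1, fun u hu a ha => ?_⟩, fun t ht => ht.2⟩
    have h := hu ⟨show (s.atom ha).1 ≤ s from Finset.singleton_subset_iff.2 ha, (s.atom ha).2⟩
    exact Finset.singleton_subset_iff.1 (Face.le_iff.1 h)
  · have hx : x.1 ⊆ z.1 := hz.1 (Or.inl rfl)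
    have hy : y.1 ⊆ z.1 := hz.1 (Or.inr rfl)
    let w : K.Face :=
      ⟨x.1 ∪ y.1, squarefreeMonomial_mem_of_subset (Finset.union_subset hx hy) z.2⟩
    have hzw : z ≤ w := by
      refine hz.2 ?_
      rintro _ (rfl | rfl)
      · exact Finset.subset_union_left
      · exact Finset.subset_union_right
    have h1 : z.1.card ≤ (x.1 ∪ y.1).card := Finset.card_le_card hzw
    have h2 := Finset.card_union_add_card_inter x.1 y.1
    change (x.1 ∩ y.1).card + z.1.card ≤ x.1.card + y.1.card
    omega

/-- The variable corresponding to an atom of the face poset. -/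
noncomputable def atomVar (a : Atoms K.Face) : σ := (Face.isAtom_iff.1 a.2).choose

theorem singleton_atomVar (a : Atoms K.Face) : a.1.1 = {atomVar a} :=
  (Face.isAtom_iff.1 a.2).choose_spec

theorem atomVar_injective : Function.Injective (atomVar : Atoms K.Face → σ) := fun a b h =>
  Subtype.ext (Subtype.ext (by rw [singleton_atomVar, singleton_atomVar, h]))

theorem atomVar_atom (s : K.Face) {a : σ} (ha : a ∈ s.1) : atomVar (s.atom ha) = a :=
  (Finset.singleton_injective (singleton_atomVar (s.atom ha))).symm

theorem atom_le_iff {a : Atoms K.Face} {s : K.Face} : a.1 ≤ s ↔ atomVar a ∈ s.1 := by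
  rw [Face.le_iff, singleton_atomVar, Finset.singleton_subset_iff]

variable (K) in
/-- The multicomplex, written in the variables given by the atoms of the face poset. -/
def atomCarrier : Set (Atoms K.Face →₀ ℕ) := {m | m.mapDomain atomVar ∈ K.carrier}

theorem mapDomain_atomVar_le_iff {m p : Atoms K.Face →₀ ℕ} :
    m.mapDomain atomVar ≤ p.mapDomain atomVar ↔ m ≤ p := by
  constructor
  · intro h a
    have := h (atomVar a)
    rwa [Finsupp.mapDomain_apply atomVar_injective, Finsupp.mapDomain_apply atomVar_injective]
      at this
  · intro h c
    by_cases hc : c ∈ Set.range (atomVar : Atoms K.Face → σ)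
    · obtain ⟨a, rfl⟩ := hc
      rw [Finsupp.mapDomain_apply atomVar_injective, Finsupp.mapDomain_apply atomVar_injective]
      exact h a
    · rw [Finsupp.mapDomain_of_notMem_range m c hc]
      exact Nat.zero_le _

theorem isLowerSet_atomCarrier (K : Multicomplex σ) : IsLowerSet K.atomCarrier :=
  fun _ _ h hm => K.isLowerSet (mapDomain_atomVar_le_iff.2 h) hm

theorem isAtomMonomial_iff_mapDomain {s : K.Face} {m : Atoms K.Face →₀ ℕ} :
    IsAtomMonomial s m ↔ m.mapDomain atomVar = squarefreeMonomial s.1 := by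
  classical
  constructor
  · intro h
    ext c
    rw [squarefreeMonomial_apply]
    by_cases hc : c ∈ Set.range (atomVar : Atoms K.Face → σ)
    · obtain ⟨a, rfl⟩ := hc
      rw [Finsupp.mapDomain_apply atomVar_injective, h a]
      simp only [atom_le_iff]
    · rw [Finsupp.mapDomain_of_notMem_range m c hc, if_neg fun hcs => hc ⟨_, atomVar_atom s hcs⟩]
  · intro h a
    have := DFunLike.congr_fun h (atomVar a)
    rw [Finsupp.mapDomain_apply atomVar_injective, squarefreeMonomial_apply] at this
    simp only [this, atom_le_iff]

theorem degree_mapDomain_atomVar (m : Atoms K.Face →₀ ℕ) :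
    (m.mapDomain atomVar).degree = m.degree := by
  classical
  rw [Finsupp.degree_apply, Finsupp.degree_apply,
    Finsupp.mapDomain_support_of_injective atomVar_injective,
    Finset.sum_image fun _ _ _ _ h => atomVar_injective h]
  exact Finset.sum_congr rfl fun a _ => Finsupp.mapDomain_apply atomVar_injective m a

theorem squarefree_mem_atomCarrier_iff {m : Atoms K.Face →₀ ℕ} :
    (m ∈ K.atomCarrier ∧ ∀ a, m a ≤ 1) ↔ ∃ s : K.Face, IsAtomMonomial s m := by
  constructor
  · rintro ⟨hm, hsq⟩
    have h : ∀ c, m.mapDomain atomVar c ≤ 1 := by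
      intro c
      by_cases hc : c ∈ Set.range (atomVar : Atoms K.Face → σ)
      · obtain ⟨a, rfl⟩ := hc
        rw [Finsupp.mapDomain_apply atomVar_injective]
        exact hsq a
      · rw [Finsupp.mapDomain_of_notMem_range m c hc]
        exact Nat.zero_le 1
    have heq := eq_squarefreeMonomial_support h
    exact ⟨⟨_, heq ▸ hm⟩, isAtomMonomial_iff_mapDomain.2 heq⟩
  · rintro ⟨s, hs⟩
    refine ⟨?_, fun a => ?_⟩
    · change _ ∈ K.carrier
      rw [isAtomMonomial_iff_mapDomain.1 hs]
      exact s.2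
    · rw [hs a]
      split_ifs <;> omega

/-- On square-free monomials, divisibility is inclusion of supports and degree is cardinality, so
the face poset is recovered. This is stage 0 of the exhaustion. -/
theorem isInitial_divisibilityPoset (K : Multicomplex σ) :
    IsInitial (MonomialPoset.divisibilityPoset
      {m : Atoms K.Face →₀ ℕ | m ∈ K.atomCarrier ∧ ∀ a, m a ≤ 1}) := by
  have hle : ∀ {s t : K.Face} {p q : Atoms K.Face →₀ ℕ}, IsAtomMonomial s p →
      IsAtomMonomial t q → (p ≤ q ↔ s ≤ t) := by
    classical
    intro s t p q hp hq
    rw [← mapDomain_atomVar_le_iff, isAtomMonomial_iff_mapDomain.1 hp,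
      isAtomMonomial_iff_mapDomain.1 hq, Face.le_iff]
    constructor
    · intro h
      have := Finsupp.support_mono h
      rwa [support_squarefreeMonomial, support_squarefreeMonomial] at this
    · intro h a
      rw [squarefreeMonomial_apply, squarefreeMonomial_apply]
      by_cases ha : a ∈ s.1
      · rw [if_pos ha, if_pos (h ha)]
      · rw [if_neg ha]
        exact Nat.zero_le _
  refine ⟨fun m => squarefree_mem_atomCarrier_iff, fun s m hs => ?_, fun p q => ⟨?_, ?_⟩⟩
  · change Finsupp.degree m = _
    rw [← degree_mapDomain_atomVar, isAtomMonomial_iff_mapDomain.1 hs,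
      degree_squarefreeMonomial, Face.grade_eq]
  · rintro ⟨hp, hq, h⟩
    obtain ⟨s, hs⟩ := squarefree_mem_atomCarrier_iff.1 hp
    obtain ⟨t, ht⟩ := squarefree_mem_atomCarrier_iff.1 hq
    exact ⟨s, t, hs, ht, (hle hs ht).1 h⟩
  · rintro ⟨s, t, hs, ht, h⟩
    exact ⟨squarefree_mem_atomCarrier_iff.2 ⟨s, hs⟩, squarefree_mem_atomCarrier_iff.2 ⟨t, ht⟩,
      (hle hs ht).2 h⟩

theorem inFamily_divisibilityPoset [Finite σ] (K : Multicomplex σ) :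
    InFamily K.Face (MonomialPoset.divisibilityPoset K.atomCarrier) := by
  have := (Face.isGeometricMeetSemilattice K).finite_atoms
  obtain ⟨e, he⟩ :=
    MonomialPoset.exists_enumeration_infinitely_often (Atoms K.Face →₀ ℕ)
  exact ⟨fun n => MonomialPoset.divisibilityPoset
      (MonomialPoset.exhaustion K.atomCarrier e n), isInitial_divisibilityPoset K,
    MonomialPoset.exhaustion_step (isLowerSet_atomCarrier K) e,
    MonomialPoset.isUnion_exhaustion (isLowerSet_atomCarrier K) he⟩

/-- Variables not occurring in K give no atom, but each variable of p does, as the square-free part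
of p lies in K. -/
theorem exists_mapDomain_atomVar_eq {p : σ →₀ ℕ} (hp : p ∈ K.carrier) :
    ∃ m : Atoms K.Face →₀ ℕ, m.mapDomain atomVar = p := by
  classical
  have hs : squarefreeMonomial p.support ∈ K.carrier := by
    refine K.isLowerSet (fun a => ?_) hp
    rw [squarefreeMonomial_apply]
    split_ifs with h
    · exact Nat.one_le_iff_ne_zero.2 (Finsupp.mem_support_iff.1 h)
    · exact Nat.zero_le _
  refine ⟨p.comapDomain atomVar atomVar_injective.injOn,
    Finsupp.mapDomain_comapDomain _ atomVar_injective p fun c hc => ?_⟩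
  exact ⟨_, atomVar_atom (⟨p.support, hs⟩ : K.Face) hc⟩

theorem divisibilityPoset_isoTo (K : Multicomplex σ) :
    (MonomialPoset.divisibilityPoset K.atomCarrier).IsoTo K.carrier
      (fun m => Finsupp.degree m.1) := by
  let f : (MonomialPoset.divisibilityPoset K.atomCarrier).carrier → K.carrier :=
    fun m => ⟨m.1.mapDomain atomVar, m.2⟩
  have hf : Function.Bijective f := by
    refine ⟨fun m p h => ?_, fun ⟨p, hp⟩ => ?_⟩
    · exact Subtype.ext
        (Finsupp.mapDomain_injective atomVar_injective (congrArg Subtype.val h))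
    · obtain ⟨m, rfl⟩ := exists_mapDomain_atomVar_eq hp
      exact ⟨⟨m, hp⟩, rfl⟩
  let e := Equiv.ofBijective f hf
  have key : ∀ x : K.carrier, ∃ m, x = f m ∧ e.symm x = m := fun x =>
    ⟨e.symm x, (e.apply_symm_apply x).symm, rfl⟩
  refine ⟨e.symm, fun x y => ?_, fun x => ?_⟩
  · obtain ⟨m, rfl, hm⟩ := key x
    obtain ⟨p, rfl, hp⟩ := key y
    rw [hm, hp]
    exact mapDomain_atomVar_le_iff.trans ⟨fun h => ⟨m.2, p.2, h⟩, fun h => h.2.2⟩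
  · obtain ⟨m, rfl, hm⟩ := key x
    rw [hm]
    exact (degree_mapDomain_atomVar m.1).symm

end Multicomplex

end Multicomplex

theorem mainTheorem3 :
    (∀ (L : Type u) [SemilatticeInf L] [OrderBot L] [GradeMinOrder ℕ L],
      IsGeometricMeetSemilattice L → ∀ P : MonomialPoset (Atoms L), InFamily L P →
        (∀ j, (P.level j).Finite) ∧ P.levelCard 0 = 1 ∧ P.MacaulayInequalities) ∧
    (∀ (L : Type u) [SemilatticeInf L] [OrderBot L] [GradeMinOrder ℕ L],
      IsGeometricMeetSemilattice L → ∃ P : MonomialPoset (Atoms L), InFamily L P ∧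
        P.IsoTo L (grade ℕ)) ∧
    (∀ (σ : Type u) [Finite σ] (I : Set (σ →₀ ℕ)), IsLowerSet I → I.Nonempty →
      ∃ (L : Type u) (_ : SemilatticeInf L) (_ : OrderBot L) (_ : GradeMinOrder ℕ L),
        IsGeometricMeetSemilattice L ∧ ∃ P : MonomialPoset (Atoms L), InFamily L P ∧
          P.IsoTo I (fun m => Finsupp.degree m.1)) := by
  refine ⟨fun L _ _ _ hL P hP => ?_, fun L _ _ _ hL => hL.exists_inFamily_isoTo,
    fun σ _ I hI hne => ?_⟩
  · obtain ⟨hC, hr⟩ := hP.isMonomialExtension hL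
    exact MonomialPoset.macaulayInequalities_of_isMonomialExtension hL hC hr
  · let K : Multicomplex σ := ⟨I, hI, hne⟩
    exact ⟨K.Face, inferInstance, inferInstance, inferInstance,
      Multicomplex.Face.isGeometricMeetSemilattice K, _,
      Multicomplex.inFamily_divisibilityPoset K, Multicomplex.divisibilityPoset_isoTo K⟩
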